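/- Conventions. All graphs are finite, simple and undirected. A group $G$ is metacyclic if it has a cyclic normal subgroup $N$ with $G/N$ cyclic. A graph $\Gamma$ is a Cayley graph of a group $G$ if it is isomorphic to the graph $\mathrm{Cay}(G,S)$ with vertex set $G$ and edge set $\{\{g,sg\} : g\in G,\ s\in S\}$ for some inverse-closed $S\subseteq G\setminus\{1\}$. $\Gamma$ is a weak metacirculant if it has a metacyclic group of automorphisms that is transitive on vertices. For integers $a\ge 1$, $b\ge 2$, a graph of order $ab$ is an $(a,b)$-metacirculant if it has an automorphism $\sigma$ of order $b$ such that $\langle\sigma\rangle$ is semiregular on the vertices, and an automorphism $\tau$ normalizing $\langle\sigma\rangle$, cyclically permuting the $a$ orbits of $\langle\sigma\rangle$, and having a cycle of size $a$ in its cycle decomposition on the vertices; a metacirculant is an $(a,b)$-metacirculant for some $a,b$. For integers $M\ge 3$, $N\ge 2$, a positive divisor $s$ of $M$ and $t\in\mathbb{Z}_M^*$, the multilayer generalized Petersen graph $\mathrm{MP}_{M,N,s,t}$ has vertex set $\mathbb{Z}_M\times\mathbb{Z}_N$ and edges $\{(j,i),(j\pm(ks+t^i),i)\}$ and $\{(j,i),(j,i+1)\}$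 for $j\in\mathbb{Z}_M$, $0\le i<N$, $0\le k<M/s$ (second coordinates are read modulo $N$). Theorem. Let $p$ be an odd prime, let $m,n$ be integers with $m\ge n+2\ge 3$, and let $\lambda\in\mathbb{Z}_{p^m}^*$ have order $p^{n+1}$. Put $\Gamma=\mathrm{MP}_{p^m,p^n,p^{m-1},\lambda}$ and $$\mathcal{G}=\langle x,y,z \mid x^{p^{m-1}}=y^{p^n}=z^p=1,\ y^{-1}xy=x^{\lambda},\ [z,x]=[z,y]=1\rangle .$$ Then $\Gamma$ is a metacirculant, and in particular a weak metacirculant; the group $\mathcal{G}$ is not metacyclic; $\Gamma$ is a Cayley graph of $\mathcal{G}$; and $\Gamma$ is not a Cayley graph of any metacyclic group. -/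

import Mathlib

/-- A group is metacyclic if it has a cyclic normal subgroup with cyclic quotient. -/
def IsMetacyclic (G : Type*) [Group G] : Prop :=
  ∃ N : Subgroup G, ∃ _ : N.Normal, IsCyclic N ∧ IsCyclic (G ⧸ N)

namespace SimpleGraph

variable {V : Type*}

/-- `Γ` has a metacyclic group of automorphisms that is transitive on the vertices. -/
def IsWeakMetacirculant (Γ : SimpleGraph V) : Prop :=
  ∃ X : Subgroup (Γ ≃g Γ), IsMetacyclic X ∧ ∀ u v : V, ∃ g ∈ X, g u = v

/-- `Γ` is an `(m, n)`-metacirculant: it has `m * n` vertices, an automorphism `σ` of order `n`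
generating a semiregular group, and an automorphism `τ` normalizing `⟨σ⟩`, permuting the (`m`)
orbits of `⟨σ⟩` cyclically (i.e. `⟨τ⟩` is transitive on the set of these orbits), and having a
cycle of size `m` (a fixed point being a cycle of size `1`). -/
def IsMetacirculantWith (Γ : SimpleGraph V) (m n : ℕ) : Prop :=
  1 ≤ m ∧ 2 ≤ n ∧ Nat.card V = m * n ∧
    ∃ σ τ : Γ ≃g Γ,
      orderOf σ = n ∧
      (∀ g ∈ Subgroup.zpowers σ, ∀ v : V, g v = v → g = 1) ∧
      (∀ g : Γ ≃g Γ, g ∈ Subgroup.zpowers σ ↔ τ * g * τ⁻¹ ∈ Subgroup.zpowers σ) ∧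
      (∀ u v : V, ∃ k : ℕ, ∃ g ∈ Subgroup.zpowers σ, g ((τ ^ k) u) = v) ∧
      ∃ v : V, Function.minimalPeriod τ v = m

/-- `Γ` is an `(m, n)`-metacirculant for some `m` and `n`. -/
def IsMetacirculant (Γ : SimpleGraph V) : Prop :=
  ∃ m n : ℕ, Γ.IsMetacirculantWith m n

/-- `Γ` is isomorphic to a Cayley graph of `G` with respect to an inverse-closed set `S` not
containing `1`. In `mulCayley S` the neighbours of `g` are the `g * s` with `s ∈ S`; the map
`g ↦ g⁻¹` is an isomorphism onto the Cayley graph in which they are the `s * g`. -/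
def IsCayleyGraphOf (Γ : SimpleGraph V) (G : Type*) [Group G] : Prop :=
  ∃ S : Set G, 1 ∉ S ∧ (∀ s ∈ S, s⁻¹ ∈ S) ∧ Nonempty (Γ ≃g mulCayley S)

end SimpleGraph

namespace MultilayerPetersen

/-- The edges inside layer `i`: `{(j, i), (j ± (k s + t ^ i), i)}` with `j ∈ ℤ/m` and
`0 ≤ k < m / s`. The vertex `(h ^ j, i)`, for a generator `h` of a cyclic group of order `m`, is
written `(j, i)`, and `t ^ i` uses the representative `0 ≤ i < n` of the layer. -/
def layerEdges (m n s : ℕ) (t : (ZMod m)ˣ) (i : ZMod n) : Set (Sym2 (ZMod m × ZMod n)) :=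
  {e | ∃ (j : ZMod m) (k : ℕ), k < m / s ∧
    (e = s((j, i), (j + ((k * s : ℕ) : ZMod m) + (t : ZMod m) ^ i.val, i)) ∨
      e = s((j, i), (j - ((k * s : ℕ) : ZMod m) - (t : ZMod m) ^ i.val, i)))}

/-- The edges `{(j, i), (j, i + 1)}` between layers `i` and `i + 1`. -/
def spokes (m n : ℕ) (i : ZMod n) : Set (Sym2 (ZMod m × ZMod n)) :=
  {e | ∃ j : ZMod m, e = s((j, i), (j, i + 1))}

/-- The multilayer generalized Petersen graph `MP_{m, n, s, t}` (meant for `m ≥ 3`, `n ≥ 2`,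
`s ∣ m`, `1 ≤ s`). -/
def graph (m n s : ℕ) (t : (ZMod m)ˣ) : SimpleGraph (ZMod m × ZMod n) :=
  SimpleGraph.fromEdgeSet (⋃ i : ZMod n, layerEdges m n s t i ∪ spokes m n i)

open FreeGroup in
/-- The relators, in the free group on `x = of 0`, `y = of 1`, `z = of 2`, of the presentation
`x ^ (p ^ (m - 1)) = y ^ (p ^ n) = z ^ p = 1`, `y⁻¹ x y = x ^ l`, `[z, x] = [z, y] = 1`. -/
def relators (p m n : ℕ) (l : (ZMod (p ^ m))ˣ) : Set (FreeGroup (Fin 3)) :=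
  {of 0 ^ (p ^ (m - 1)), of 1 ^ (p ^ n), of 2 ^ p,
    (of 1)⁻¹ * of 0 * of 1 * (of 0 ^ (l : ZMod (p ^ m)).val)⁻¹,
    (of 2)⁻¹ * (of 0)⁻¹ * of 2 * of 0, (of 2)⁻¹ * (of 1)⁻¹ * of 2 * of 1}

/-- The group
`⟨x, y, z | x ^ (p ^ (m - 1)) = y ^ (p ^ n) = z ^ p = 1, y⁻¹ x y = x ^ l, [z, x] = [z, y] = 1⟩`. -/
abbrev XYZGroup (p m n : ℕ) (l : (ZMod (p ^ m))ˣ) : Type :=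
  PresentedGroup (relators p m n l)

end MultilayerPetersen

/-! Since `s = p^(m-1)`, the multiples `k s` fill the kernel of reduction modulo `p^(m-1)`. Edges
inside a layer therefore see positions only modulo `p^(m-1)`, and layer `i` has slope `±λ^i` there.
Modulo `p^(m-1)` the order of `λ` divides `p^n`, the number of layers, so multiplication by `λ`
combined with the layer shift is an automorphism. With the translations it gives the metacirculant
structure.

Layer edges lie on 4-cycles because of that kernel; spokes do not, because `λ ≠ ±1` modulo
`p^(m-1)`. Hence automorphisms respect layers, and the fourth power of any automorphism induces an
affine map of slope `λ^c` modulo `p^(m-1)`, where `c` is its shift of the layers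
(`exists_affine_pow_four`). A regular group `G` has odd order `p^(m+n)`, so all its elements are
fourth powers. This yields a cocycle pair `(c, b)` on `G` whose kernel `K` has order `p` and is
central.

Take `h`, `y` in `G` moving the origin to `(1, 0)` and `(0, 1)`. If `h^(p^(m-1)) = 1`, then `K` and
suitable powers of `h` and `y` generate an elementary abelian group of order `p^3`, which no
metacyclic group contains. Otherwise `⟨h⟩` has order `p^m` and contains `K`, and `y`, with `y^(p^n)
= 1`, acts on it by an exponent congruent to `λ` modulo `p^(m-1)`; this forces `λ^(p^n) = 1`,
against the order of `λ`. So `G` is not metacyclic (`not_isMetacyclic_of_cocycle`).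

Finally, positions may be permuted freely within the fibres of the reduction. Splitting `ℤ/p^m` as
the set `ℤ/p^(m-1) × ℤ/p` gives a regular action of `𝒢`, and so `𝒢` is not metacyclic either. -/

namespace MultilayerPetersen

/-! ### Automorphisms of layered graphs -/

section Layered

set_option linter.unusedSectionVars false

variable {A R I : Type*} [CommRing A] [CommRing R] [CommRing I]

/-- Two vertices of the same layer `i` whose images in `R` differ by `± L i`. -/
def LayerAdj (d : A →+* R) (L : I → R) (u v : A × I) : Prop :=
  u.2 = v.2 ∧ (d v.1 - d u.1 = L u.2 ∨ d u.1 - d v.1 = L u.2)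

/-- Two vertices at the same position of consecutive layers. -/
def SpokeAdj (u v : A × I) : Prop :=
  u.1 = v.1 ∧ (v.2 = u.2 + 1 ∨ u.2 = v.2 + 1)

/-- A graph on `A × I` whose edges are the layer edges and the spokes. -/
def IsLayered (Γ : SimpleGraph (A × I)) (d : A →+* R) (L : I → R) : Prop :=
  ∀ u v, Γ.Adj u v ↔ LayerAdj d L u v ∨ SpokeAdj u v

/-- The arithmetic conditions under which the automorphisms of a layered graph are determined. -/
structure IsRigid (d : A →+* R) (L : I → R) : Prop where
  natCast_A : ∀ a : A, ∃ k : ℕ, (k : A) = a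
  natCast_I : ∀ i : I, ∃ k : ℕ, (k : I) = i
  ker_ne_bot : ∃ q : A, q ≠ 0 ∧ d q = 0
  two_R : IsUnit (2 : R)
  two_I : IsUnit (2 : I)
  nontrivial_R : Nontrivial R
  nontrivial_I : Nontrivial I
  exists_lift : ∀ i, ∃ a : A, IsUnit a ∧ d a = L i
  L_zero : L 0 = 1
  L_add : ∀ i j, L (i + j) = L i * L j
  L_one_ne : L 1 ≠ 1
  L_one_ne' : L 1 ≠ -1

theorem LayerAdj.symm {d : A →+* R} {L : I → R} {u v : A × I} (h : LayerAdj d L u v) :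
    LayerAdj d L v u :=
  ⟨h.1.symm, by rw [← h.1]; exact h.2.symm⟩

theorem SpokeAdj.symm {u v : A × I} (h : SpokeAdj u v) : SpokeAdj v u :=
  ⟨h.1.symm, h.2.symm⟩

/-- The path `u v` extends to a 4-cycle. -/
def InFourCycle {V : Type*} (Γ : SimpleGraph V) (u v : V) : Prop :=
  ∃ w w', w ≠ u ∧ w' ≠ v ∧ Γ.Adj v w ∧ Γ.Adj w w' ∧ Γ.Adj w' u

theorem InFourCycle.map {V : Type*} {Γ : SimpleGraph V} {u v : V} (h : InFourCycle Γ u v)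
    (f : Γ ≃g Γ) : InFourCycle Γ (f u) (f v) := by
  obtain ⟨w, w', h1, h2, h3, h4, h5⟩ := h
  exact ⟨f w, f w', f.injective.ne h1, f.injective.ne h2, f.map_adj_iff.2 h3, f.map_adj_iff.2 h4,
    f.map_adj_iff.2 h5⟩

/-- The neighbour of a vertex in the next layer. -/
def up (v : A × I) : A × I := (v.1, v.2 + 1)

/-- The neighbour of a vertex in the previous layer. -/
def down (v : A × I) : A × I := (v.1, v.2 - 1)

@[simp] theorem up_down (v : A × I) : up (down v) = v := by simp [up, down]

@[simp] theorem down_up (v : A × I) : down (up v) = v := by simp [up, down]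

theorem spokeAdj_up (v : A × I) : SpokeAdj v (up v) := ⟨rfl, Or.inl rfl⟩

theorem spokeAdj_iff {u v : A × I} : SpokeAdj u v ↔ v = up u ∨ v = down u := by
  obtain ⟨a, i⟩ := u
  obtain ⟨b, j⟩ := v
  simp only [SpokeAdj, up, down, Prod.mk.injEq]
  grind

namespace IsRigid

variable {d : A →+* R} {L : I → R}

theorem two_ne_zero_R (H : IsRigid d L) : (2 : R) ≠ 0 :=
  have := H.nontrivial_R
  H.two_R.ne_zero

theorem four_ne_zero_R (H : IsRigid d L) : (4 : R) ≠ 0 := by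
  have := H.nontrivial_R
  have h := (H.two_R.mul H.two_R).ne_zero
  norm_num at h
  exact h

theorem one_ne_zero_I (H : IsRigid d L) : (1 : I) ≠ 0 :=
  have := H.nontrivial_I
  one_ne_zero

theorem two_ne_zero_I (H : IsRigid d L) : (2 : I) ≠ 0 :=
  have := H.nontrivial_I
  H.two_I.ne_zero

theorem four_ne_zero_I (H : IsRigid d L) : (4 : I) ≠ 0 := by
  have := H.nontrivial_I
  have h := (H.two_I.mul H.two_I).ne_zero
  norm_num at h
  exact h

theorem isUnit_L (H : IsRigid d L) (i : I) : IsUnit (L i) :=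
  IsUnit.of_mul_eq_one (L (-i)) (by rw [← H.L_add, add_neg_cancel, H.L_zero])

theorem L_ne_zero (H : IsRigid d L) (i : I) : L i ≠ 0 :=
  have := H.nontrivial_R
  (H.isUnit_L i).ne_zero

theorem L_succ_ne (H : IsRigid d L) (i : I) : L (i + 1) ≠ L i := fun h =>
  H.L_one_ne ((H.isUnit_L i).mul_left_cancel (by rw [← H.L_add, h, mul_one]))

theorem L_succ_ne_neg (H : IsRigid d L) (i : I) : L (i + 1) ≠ -L i := fun h =>
  H.L_one_ne' ((H.isUnit_L i).mul_left_cancel (by rw [← H.L_add, h, mul_neg, mul_one]))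

end IsRigid

variable {d : A →+* R} {L : I → R} {Γ : SimpleGraph (A × I)}

/-- Translating both ends by a nonzero `q` in the kernel of `d` gives the other two vertices. -/
theorem LayerAdj.inFourCycle (H : IsRigid d L) (hΓ : IsLayered Γ d L) {u v : A × I}
    (h : LayerAdj d L u v) : InFourCycle Γ u v := by
  obtain ⟨q, hq, hdq⟩ := H.ker_ne_bot
  obtain ⟨a, i⟩ := u
  obtain ⟨b, j⟩ := v
  obtain ⟨h1, h2⟩ := h
  dsimp only at h1 h2
  subst h1
  refine ⟨(a + q, i), (b + q, i), by simpa using hq, by simpa using hq, (hΓ _ _).2 (Or.inl ?_),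
    (hΓ _ _).2 (Or.inl ?_), (hΓ _ _).2 (Or.inl ?_)⟩ <;>
  · simp only [LayerAdj, map_add, hdq, add_zero, true_and]
    tauto

/-- A 4-cycle through a spoke would need slopes of consecutive layers to agree up to sign, a zero
slope, or `1`, `2` or `4` to vanish in `I`. -/
theorem not_inFourCycle_up (H : IsRigid d L) (hΓ : IsLayered Γ d L) (v : A × I) :
    ¬ InFourCycle Γ v (up v) := by
  obtain ⟨a, i⟩ := v
  rintro ⟨⟨b, j⟩, ⟨c, k⟩, h1, h2, h3, h4, h5⟩
  rw [hΓ] at h3 h4 h5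
  have e1 := H.one_ne_zero_I
  have e2 := H.two_ne_zero_I
  have e4 := H.four_ne_zero_I
  have l0 := H.L_ne_zero i
  have l1 := H.L_ne_zero (i + 1)
  have l2 := H.L_succ_ne i
  have l3 := H.L_succ_ne_neg i
  simp only [LayerAdj, SpokeAdj, up, ne_eq, Prod.mk.injEq, not_and] at *
  rcases h3 with ⟨rfl, h3⟩ | ⟨rfl, h3⟩ <;> rcases h5 with ⟨rfl, h5⟩ | ⟨rfl, h5⟩
  · rcases h4 with ⟨h4, -⟩ | ⟨rfl, h4⟩ <;> grind
  · rcases h4 with ⟨h4, -⟩ | ⟨rfl, h4⟩ <;> grind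
  · rcases h4 with ⟨h4, -⟩ | ⟨rfl, h4⟩ <;> grind
  · rcases h4 with ⟨-, h4⟩ | ⟨-, h4⟩
    · exact H.L_ne_zero j (by simpa [eq_comm] using h4)
    · grind

theorem SpokeAdj.not_inFourCycle (H : IsRigid d L) (hΓ : IsLayered Γ d L) {u v : A × I}
    (h : SpokeAdj u v) : ¬ InFourCycle Γ u v := by
  rcases spokeAdj_iff.1 h with rfl | rfl
  · exact not_inFourCycle_up H hΓ u
  · rintro ⟨w, w', h1, h2, h3, h4, h5⟩
    refine not_inFourCycle_up H hΓ (down u) ?_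
    rw [up_down]
    exact ⟨w', w, h2, h1, h5.symm, h4.symm, h3.symm⟩

/-- Lying on a 4-cycle is invariant under automorphisms and separates the two kinds of edges. -/
theorem LayerAdj.map (H : IsRigid d L) (hΓ : IsLayered Γ d L) (f : Γ ≃g Γ) {u v : A × I}
    (h : LayerAdj d L u v) : LayerAdj d L (f u) (f v) :=
  ((hΓ _ _).1 (f.map_adj_iff.2 ((hΓ _ _).2 (Or.inl h)))).resolve_right fun h' =>
    h'.not_inFourCycle H hΓ ((h.inFourCycle H hΓ).map f)

theorem SpokeAdj.map (H : IsRigid d L) (hΓ : IsLayered Γ d L) (f : Γ ≃g Γ) {u v : A × I}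
    (h : SpokeAdj u v) : SpokeAdj (f u) (f v) :=
  ((hΓ _ _).1 (f.map_adj_iff.2 ((hΓ _ _).2 (Or.inr h)))).resolve_left fun h' => by
    have := (h'.inFourCycle H hΓ).map f.symm
    rw [f.symm_apply_apply, f.symm_apply_apply] at this
    exact h.not_inFourCycle H hΓ this

theorem map_up_eq_or (H : IsRigid d L) (hΓ : IsLayered Γ d L) (f : Γ ≃g Γ) (v : A × I) :
    f (up v) = up (f v) ∨ f (up v) = down (f v) :=
  spokeAdj_iff.1 ((spokeAdj_up v).map H hΓ f)

theorem up_up_ne (H : IsRigid d L) (v : A × I) : up (up v) ≠ v := fun h => by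
  have := congrArg Prod.snd h
  have e2 := H.two_ne_zero_I
  simp only [up] at this
  grind

/-- A property of vertices that propagates upwards and along layer edges holds everywhere. -/
theorem forall_of_up_of_layerAdj (H : IsRigid d L) {P : A × I → Prop} (hu : ∀ v, P v → P (up v))
    (hl : ∀ u v, LayerAdj d L u v → P u → P v) {v : A × I} (hv : P v) (w : A × I) : P w := by
  have key : ∀ (a : A) (i : I) (k : ℕ), P (a, i) → P (a, i + k) := by
    intro a i k h
    induction k with
    | zero => simpa using h
    | succ k ih => simpa [up, add_assoc] using hu _ ih
  have key' : ∀ (a : A) (i j : I), P (a, i) → P (a, j) := by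
    intro a i j h
    obtain ⟨k, hk⟩ := H.natCast_I (j - i)
    simpa [hk] using key a i k h
  have key2 : ∀ (a : A) (k : ℕ), P (a, 0) → P (a + k, 0) := by
    intro a k h
    induction k with
    | zero => simpa using h
    | succ k ih =>
      refine hl _ _ ?_ ih
      simp [LayerAdj, H.L_zero]
  obtain ⟨a, i⟩ := v
  obtain ⟨b, j⟩ := w
  obtain ⟨k, hk⟩ := H.natCast_A (b - a)
  have := key2 a k (key' a i 0 hv)
  rw [hk, add_sub_cancel] at this
  exact key' b 0 j this

/-- An automorphism maps layers to layers. -/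
theorem map_snd_eq (H : IsRigid d L) (hΓ : IsLayered Γ d L) (f : Γ ≃g Γ) (a b : A) (i : I) :
    (f (a, i)).2 = (f (b, i)).2 := by
  -- Steps by a unit lift `c` of `L i` follow layer edges and reach every position of the layer.
  obtain ⟨c, hc, hdc⟩ := H.exists_lift i
  have key : ∀ k : ℕ, (f (a, i)).2 = (f (a + k * c, i)).2 := by
    intro k
    induction k with
    | zero => simp
    | succ k ih =>
      have h : LayerAdj d L (a + k * c, i) (a + (k + 1 : ℕ) * c, i) := by
        refine ⟨rfl, Or.inl ?_⟩
        simp only [map_add, map_mul, map_natCast, hdc]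
        push_cast
        ring
      exact ih.trans (h.map H hΓ f).1
  obtain ⟨e, he⟩ := hc.exists_left_inv
  obtain ⟨k, hk⟩ := H.natCast_A ((b - a) * e)
  rw [key k, hk, mul_assoc, he, mul_one, add_sub_cancel]

/-- An automorphism preserves or reverses the cyclic order of the layers. -/
theorem forall_map_up_eq_or (H : IsRigid d L) (hΓ : IsLayered Γ d L) (f : Γ ≃g Γ) :
    (∀ v, f (up v) = up (f v)) ∨ (∀ v, f (up v) = down (f v)) := by
  by_contra! hc
  obtain ⟨⟨v, hv⟩, w, hw⟩ := hc
  refine hv (forall_of_up_of_layerAdj H (P := fun v => f (up v) = up (f v)) ?_ ?_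
    ((map_up_eq_or H hΓ f w).resolve_right hw) v)
  · intro v hv
    refine (map_up_eq_or H hΓ f (up v)).resolve_right fun h => ?_
    rw [hv, down_up] at h
    exact up_up_ne H v (f.injective h)
  -- `up u` and `up v` share a layer, and so do their images; going up at `u` and down at `v` would
  -- give `2 = 0` in `I`.
  · intro u v huv hu
    refine (map_up_eq_or H hΓ f v).resolve_right fun h => ?_
    have h1 := (huv.map H hΓ f).1
    have h2 : (f (up u)).2 = (f (up v)).2 := by
      simp only [up, huv.1]
      exact map_snd_eq H hΓ f _ _ _
    rw [hu, h] at h2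
    simp only [up, down, h1] at h2
    have e2 := H.two_ne_zero_I
    grind

/-- `f` shifts the layers by a constant, acts on each of them by the same permutation of `A`, and
this permutation induces an affine map with slope `± L c` on `R`. -/
theorem exists_affine_of_map_up (H : IsRigid d L) (hΓ : IsLayered Γ d L) (f : Γ ≃g Γ)
    (hf : ∀ v, f (up v) = up (f v)) :
    ∃ (φ : A → A) (c : I) (s b : R), (s = 1 ∨ s = -1) ∧ (∀ a i, f (a, i) = (φ a, i + c)) ∧
      ∀ a, d (φ a) = s * L c * d a + b := by
  have key : ∀ (a : A) (i : I), f (a, i) = ((f (a, 0)).1, i + (f (0, 0)).2) := by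
    intro a i
    obtain ⟨k, rfl⟩ := H.natCast_I i
    induction k with
    | zero => simp [← map_snd_eq H hΓ f a 0 0]
    | succ k ih =>
      have := hf (a, k)
      rw [ih] at this
      simpa [up, add_right_comm] using this
  set φ : A → A := fun a => (f (a, 0)).1 with hφ
  set c := (f (0, 0)).2 with hc
  have hstep : ∀ a b : A, d (b - a) = 1 → d (φ b) - d (φ a) = L c ∨ d (φ a) - d (φ b) = L c := by
    intro a b hab
    have h : LayerAdj d L (a, 0) (b, 0) := ⟨rfl, Or.inl (by rw [← map_sub, hab, H.L_zero])⟩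
    have h' := (h.map H hΓ f).2
    rw [key a, key b] at h'
    simpa using h'
  -- No turning back: otherwise the images of `a - 1` and `a + 2` would be adjacent, hence so would
  -- these vertices, giving `3 = ±1` in `R`. Thus the sign in `hstep` is constant.
  have hturn : ∀ a, d (φ (a + 2)) ≠ d (φ a) := by
    intro a ha
    have h : LayerAdj d L (a - 1, 0) (a, 0) := ⟨rfl, Or.inl (by simp [H.L_zero])⟩
    have h' := h.map H hΓ f
    have h2 : LayerAdj d L (f (a - 1, 0)) (f (a + 2, 0)) := by
      rw [key (a - 1), key (a + 2)]
      rw [key (a - 1), key a] at h'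
      refine ⟨rfl, ?_⟩
      have := h'.2
      simp only at this ⊢
      change d (φ (a + 2)) - _ = _ ∨ _ - d (φ (a + 2)) = _
      rw [ha]
      exact this
    have h3 := h2.map H hΓ f.symm
    rw [f.symm_apply_apply, f.symm_apply_apply] at h3
    have h4 := h3.2
    have e2 := H.two_ne_zero_R
    have e4 := H.four_ne_zero_R
    simp only [map_add, map_sub, map_one, map_ofNat, H.L_zero] at h4
    grind
  obtain ⟨s, hs, hs1⟩ : ∃ s : R, (s = 1 ∨ s = -1) ∧ d (φ 1) - d (φ 0) = s * L c := by
    rcases hstep 0 1 (by simp) with h | h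
    · exact ⟨1, Or.inl rfl, by rw [h, one_mul]⟩
    · exact ⟨-1, Or.inr rfl, by rw [← h]; ring⟩
  have hconst : ∀ k : ℕ, d (φ (k + 1)) - d (φ k) = s * L c := by
    intro k
    induction k with
    | zero => simpa using hs1
    | succ k ih =>
      have h1 := hstep (k + 1) (k + 2) (by rw [← map_one d]; congr 1; ring)
      have h2 := hturn k
      have e : ((k + 1 : ℕ) : A) + 1 = k + 2 := by push_cast; ring
      rw [e]
      push_cast
      rcases hs with rfl | rfl <;> rcases h1 with h1 | h1 <;> grind
  refine ⟨φ, c, s, d (φ 0), hs, key, fun a => ?_⟩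
  obtain ⟨k, rfl⟩ := H.natCast_A a
  induction k with
  | zero => simp
  | succ k ih =>
    have := hconst k
    push_cast
    simp only [map_add, map_one, map_natCast] at ih ⊢
    linear_combination this + ih

/-- The fourth power of an automorphism shifts the layers by a constant, acts on each of them by
the same permutation of `A`, and this permutation induces an affine map with slope `L c` on `R`. -/
theorem exists_affine_pow_four (H : IsRigid d L) (hΓ : IsLayered Γ d L) (f : Γ ≃g Γ) :
    ∃ (φ : A → A) (c : I) (b : R), (∀ a i, (f ^ 4) (a, i) = (φ a, i + c)) ∧
      ∀ a, d (φ a) = L c * d a + b := by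
  -- Squaring undoes a reversal of the layers; the second squaring removes the sign `s`, as `(s * L
  -- c)^2 = L (c + c)`.
  have hup : ∀ v, (f * f) (up v) = up ((f * f) v) := by
    intro v
    simp only [RelIso.mul_apply]
    rcases forall_map_up_eq_or H hΓ f with h | h
    · rw [h, h]
    · rw [h]
      have h' := h (down (f v))
      rw [up_down] at h'
      rw [h', up_down]
  obtain ⟨φ, c, s, b, hs, h1, h2⟩ := exists_affine_of_map_up H hΓ (f * f) hup
  refine ⟨φ ∘ φ, c + c, s * L c * b + b, fun a i => ?_, fun a => ?_⟩
  · rw [show f ^ 4 = (f * f) * (f * f) by simp only [pow_succ, pow_zero, one_mul, mul_assoc],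
      RelIso.mul_apply, h1, h1, add_assoc]
    rfl
  · simp only [Function.comp, h2, H.L_add]
    rcases hs with rfl | rfl <;> ring

end Layered

end MultilayerPetersen

/-! ### Metacyclic groups, `p`-groups and lifting of `p`-th powers -/

/-- Commuting elements whose order divides `k`: a metacyclic group has at most `k ^ 2` of them. -/
theorem IsMetacyclic.card_le_sq {G : Type*} [Group G] [Finite G] (hG : IsMetacyclic G) {k : ℕ}
    (hk : 0 < k) (T : Finset G) (hT : ∀ s ∈ T, s ^ k = 1)
    (hcomm : ∀ s ∈ T, ∀ t ∈ T, Commute s t) : T.card ≤ k * k := by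
  classical
  obtain ⟨N, _, hN, hQ⟩ := hG
  have := Fintype.ofFinite N
  have := Fintype.ofFinite (G ⧸ N)
  -- The image in the quotient, and each fibre translated into `N` by some `t⁻¹`, consist of
  -- elements killed by `k`; a cyclic group has at most `k` of these. For the fibres this uses
  -- commutation.
  have himage : (T.image (QuotientGroup.mk : G → G ⧸ N)).card ≤ k := by
    refine le_trans (Finset.card_le_card ?_) (IsCyclic.card_pow_eq_one_le (α := G ⧸ N) hk)
    intro q hq
    obtain ⟨t, ht, rfl⟩ := Finset.mem_image.1 hq
    simp [← QuotientGroup.mk_pow, hT t ht]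
  refine (Finset.card_le_mul_card_image (f := (QuotientGroup.mk : G → G ⧸ N)) T k ?_).trans
    (Nat.mul_le_mul_left k himage)
  intro q hq
  obtain ⟨t, ht, rfl⟩ := Finset.mem_image.1 hq
  have hker := IsCyclic.card_pow_eq_one_le (α := N) hk
  rw [← Finset.card_map (Function.Embedding.subtype _)] at hker
  refine le_trans (Finset.card_le_card_of_injOn (t⁻¹ * ·) ?_ (mul_right_injective _).injOn) hker
  intro s hs
  simp only [Finset.coe_filter, Set.mem_ofPred_eq] at hs
  have hmem : t⁻¹ * s ∈ N := QuotientGroup.eq.1 hs.2.symm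
  simp only [Finset.coe_map, Function.Embedding.subtype_apply, Set.mem_image, Finset.coe_filter,
    Finset.mem_univ, true_and]
  refine ⟨⟨t⁻¹ * s, hmem⟩, Subtype.ext ?_, rfl⟩
  simp [(hcomm t ht s hs.1).inv_left.mul_pow, hT t ht, hT s hs.1]

theorem conj_pow_eq_pow_pow {G : Type*} [Group G] {g h : G} {k : ℕ} (H : g * h * g⁻¹ = h ^ k)
    (j : ℕ) : g ^ j * h * (g ^ j)⁻¹ = h ^ k ^ j := by
  induction j with
  | zero => simp
  | succ j ih =>
    calc g ^ (j + 1) * h * (g ^ (j + 1))⁻¹ = g * (g ^ j * h * (g ^ j)⁻¹) * g⁻¹ := by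
          rw [pow_succ']; group
      _ = h ^ k ^ (j + 1) := by rw [ih, ← conj_pow, H, ← pow_mul, pow_succ']

/-- A normal subgroup of order `p` of a `p`-group is central. -/
theorem Subgroup.Normal.commute_of_card_eq_prime {G : Type*} [Group G] {p N : ℕ} (hp : p.Prime)
    (hG : ∀ g : G, g ^ p ^ N = 1) {K : Subgroup G} (hK : K.Normal) (hcard : Nat.card K = p)
    {z : G} (hz : z ∈ K) (g : G) : Commute g z := by
  have := Fact.mk hp
  by_cases h1 : z = 1
  · rw [h1]; exact Commute.one_right g
  have hzp : z ^ p = 1 := by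
    have := pow_card_eq_one' (x := (⟨z, hz⟩ : K))
    rw [hcard] at this
    exact congrArg Subtype.val this
  obtain ⟨k, hk⟩ : ∃ k : ℕ, z ^ k = g * z * g⁻¹ := by
    have := mem_powers_of_prime_card hcard (g := ⟨z, hz⟩)
      (g' := ⟨g * z * g⁻¹, hK.conj_mem z hz g⟩) (by simpa using h1)
    obtain ⟨k, hk⟩ := this
    exact ⟨k, congrArg Subtype.val hk⟩
  have horder : orderOf z = p := orderOf_eq_prime hzp h1
  -- Conjugating `p^N` times gives `k^(p^N) ≡ 1` modulo `p`, hence `k ≡ 1` by Fermat.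
  have h2 := conj_pow_eq_pow_pow hk.symm (p ^ N)
  rw [hG, one_mul, inv_one, mul_one] at h2
  have h3 : z ^ k = z ^ 1 := by
    rw [pow_eq_pow_iff_modEq, horder, ← ZMod.natCast_eq_natCast_iff]
    have h4 : z ^ 1 = z ^ k ^ p ^ N := by rw [pow_one, ← h2]
    rw [pow_eq_pow_iff_modEq, horder, ← ZMod.natCast_eq_natCast_iff] at h4
    push_cast at h4
    rw [ZMod.pow_card_pow] at h4
    simpa using h4.symm
  rw [hk, pow_one] at h3
  exact mul_inv_eq_iff_eq_mul.1 h3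

/-- In `b^p - a^p = (b - a) * ∑ …` the sum is divisible by `p` because `a ≡ b` modulo `p`; this
supplies the missing factor. -/
theorem ZMod.pow_prime_eq_of_castHom_eq {p m : ℕ} (hm : 2 ≤ m) {a b : ZMod (p ^ m)}
    (h : ZMod.castHom (pow_dvd_pow p (Nat.sub_le m 1)) (ZMod (p ^ (m - 1))) a =
      ZMod.castHom (pow_dvd_pow p (Nat.sub_le m 1)) (ZMod (p ^ (m - 1))) b) : a ^ p = b ^ p := by
  obtain ⟨a, rfl⟩ := ZMod.intCast_surjective a
  obtain ⟨b, rfl⟩ := ZMod.intCast_surjective b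
  rw [map_intCast, map_intCast, ZMod.intCast_eq_intCast_iff_dvd_sub] at h
  have hdvd : (p : ℤ) ∣ b - a :=
    (dvd_trans (by exact_mod_cast dvd_pow_self p (by omega)) h)
  have h2 : ((p ^ m : ℕ) : ℤ) ∣ b ^ p - a ^ p := by
    rw [← (Commute.all b a).geom_sum₂_mul, mul_comm,
      show ((p ^ m : ℕ) : ℤ) = (p ^ (m - 1) : ℕ) * p by
        rw [← Nat.cast_mul, ← pow_succ, Nat.sub_add_cancel (by omega)]]
    exact mul_dvd_mul h (dvd_geom_sum₂_self hdvd)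
  rw [← ZMod.intCast_eq_intCast_iff_dvd_sub] at h2
  exact_mod_cast h2

/-! ### The obstruction to being metacyclic -/

namespace MultilayerPetersen

/-- Reduction modulo `p ^ (m - 1)`. -/
abbrev reduction (p m : ℕ) : ZMod (p ^ m) →+* ZMod (p ^ (m - 1)) :=
  ZMod.castHom (pow_dvd_pow p (Nat.sub_le m 1)) _

theorem castHom_eq_one_of_orderOf {p m N : ℕ} (hp : p.Prime) (hm : 1 ≤ m) {l : (ZMod (p ^ m))ˣ}
    (hl : orderOf l = p ^ N) :
    ZMod.castHom (dvd_pow_self p (Nat.one_le_iff_ne_zero.1 hm)) (ZMod p) (l : ZMod (p ^ m)) = 1 := by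
  have := Fact.mk hp
  have h : (l : ZMod (p ^ m)) ^ p ^ N = 1 := by
    rw [← hl, ← Units.val_pow_eq_pow_val, pow_orderOf_eq_one, Units.val_one]
  have h2 := congrArg (ZMod.castHom (dvd_pow_self p (Nat.one_le_iff_ne_zero.1 hm)) (ZMod p)) h
  rwa [map_pow, ZMod.pow_card_pow, map_one] at h2

/-- A `p`-group with a cocycle pair `(c, b)` as below, whose kernel has order `p`, is an extension
of `(ℤ/p^(m-1)) ⋊ ℤ/p^n` by `ℤ/p`; it is not metacyclic. -/
theorem not_isMetacyclic_of_cocycle {p m n : ℕ} (hp : p.Prime) (hmn : n + 2 ≤ m) (hn : 1 ≤ n)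
    {l : (ZMod (p ^ m))ˣ} (hl : orderOf l = p ^ (n + 1)) {G : Type*} [Group G] [Finite G]
    (hG : ∃ N, Nat.card G = p ^ N) (c : G → ZMod (p ^ n)) (b : G → ZMod (p ^ (m - 1)))
    (L : ZMod (p ^ n) → ZMod (p ^ (m - 1))) (hL0 : L 0 = 1) (hL1 : L 1 = reduction p m l)
    (hc : ∀ g h, c (g * h) = c g + c h) (hb : ∀ g h, b (g * h) = L (c g) * b h + b g)
    {h y : G} (hhc : c h = 0) (hhb : b h = 1) (hyc : c y = 1) (hyb : b y = 0)
    (hy : y ^ p ^ n = 1) (hcard : Nat.card {g : G // c g = 0 ∧ b g = 0} = p) :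
    ¬ IsMetacyclic G := by
  intro hmeta
  have := Fact.mk hp
  obtain ⟨N, hN⟩ := hG
  have hexp : ∀ g : G, g ^ p ^ N = 1 := fun g => by rw [← hN]; exact pow_card_eq_one'
  have hc1 : c 1 = 0 := by simpa using hc 1 1
  have hb1 : b 1 = 0 := by simpa [hc1, hL0] using hb 1 1
  have hcinv : ∀ g, c g⁻¹ = -c g := fun g => by
    have := hc g g⁻¹
    rw [mul_inv_cancel, hc1] at this
    linear_combination -this
  have hbinv : ∀ g, c g = 0 → b g⁻¹ = -b g := fun g hg => by
    have := hb g g⁻¹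
    rw [mul_inv_cancel, hb1, hg, hL0] at this
    linear_combination -this
  have hcpow : ∀ (g : G) (k : ℕ), c (g ^ k) = k * c g := fun g k => by
    induction k with
    | zero => simp [hc1]
    | succ k ih => rw [pow_succ, hc, ih]; push_cast; ring
  have hbpow : ∀ (g : G), c g = 0 → ∀ k : ℕ, b (g ^ k) = k * b g := fun g hg k => by
    induction k with
    | zero => simp [hb1]
    | succ k ih => rw [pow_succ', hb, ih, hg, hL0]; push_cast; ring
  have hbypow : ∀ k : ℕ, b (y ^ k) = 0 := fun k => by
    induction k with
    | zero => simp [hb1]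
    | succ k ih => rw [pow_succ', hb, ih, hyb, mul_zero, add_zero]
  let K : Subgroup G :=
    { carrier := {g | c g = 0 ∧ b g = 0}
      one_mem' := ⟨hc1, hb1⟩
      mul_mem' := fun {g g'} hg hg' => ⟨by rw [hc, hg.1, hg'.1, add_zero],
        by rw [hb, hg.2, hg'.2, mul_zero, add_zero]⟩
      inv_mem' := fun {g} hg => ⟨by rw [hcinv, hg.1, neg_zero],
        by rw [hbinv g hg.1, hg.2, neg_zero]⟩ }
  have hKmem : ∀ g, g ∈ K ↔ c g = 0 ∧ b g = 0 := fun g => Iff.rfl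
  have hKn : K.Normal := by
    refine ⟨fun z hz g => ?_⟩
    rw [hKmem] at hz ⊢
    refine ⟨by rw [hc, hc, hcinv, hz.1]; ring, ?_⟩
    have := hb g g⁻¹
    rw [mul_inv_cancel, hb1] at this
    rw [hb, hb, hc, hz.1, hz.2, add_zero]
    linear_combination -this
  have hKcard : Nat.card K = p := hcard
  have hcentral : ∀ z ∈ K, ∀ g, Commute g z := fun z hz g =>
    hKn.commute_of_card_eq_prime hp hexp hKcard hz g
  have hKp : ∀ z ∈ K, z ^ p = 1 := fun z hz => by
    have := pow_card_eq_one' (x := (⟨z, hz⟩ : K))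
    rw [hKcard] at this
    exact congrArg Subtype.val this
  have hgen : ∀ z ∈ K, z ≠ 1 → ∀ w ∈ K, ∃ k : ℕ, z ^ k = w := fun z hz h1 w hw => by
    obtain ⟨k, hk⟩ := mem_powers_of_prime_card hKcard (g := ⟨z, hz⟩) (g' := ⟨w, hw⟩)
      (by simpa using h1)
    exact ⟨k, congrArg Subtype.val hk⟩
  have hq : h ^ p ^ (m - 1) ∈ K := by
    rw [hKmem, hcpow, hbpow h hhc, hhc, hhb, mul_zero, mul_one]
    exact ⟨rfl, ZMod.natCast_self _⟩
  have hNZ : NeZero (p ^ m) := ⟨pow_ne_zero _ hp.ne_zero⟩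
  set lv := (l : ZMod (p ^ m)).val with hlv
  have hlvR : (lv : ZMod (p ^ (m - 1))) = reduction p m l := by
    rw [← map_natCast (reduction p m), hlv, ZMod.natCast_zmod_val]
  -- Both `y * h * y⁻¹` and `h ^ lv` have cocycle values `(0, λ)`, so they differ by an element of
  -- `K`.
  obtain ⟨u, hu, hyu⟩ : ∃ u ∈ K, y * h * y⁻¹ = u * h ^ lv := by
    refine ⟨y * h * y⁻¹ * (h ^ lv)⁻¹, ?_, by group⟩
    rw [hKmem]
    have hc2 : c (h ^ lv) = 0 := by rw [hcpow, hhc, mul_zero]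
    have hc' : c (y * h * y⁻¹) = 0 := by rw [hc, hc, hcinv, hhc]; ring
    have hb' : b (y * h * y⁻¹) = reduction p m l := by
      have := hb (y * h * y⁻¹) y
      rw [inv_mul_cancel_right, hb, hc', hyb, hhb, hyc, hL1] at this
      linear_combination -this
    refine ⟨by rw [hc, hc', hcinv, hc2]; ring, ?_⟩
    rw [hb, hc', hb', hbinv _ hc2, hbpow h hhc, hL0, hhb, hlvR]
    ring
  by_cases hcase : h ^ p ^ (m - 1) = 1
  · -- `h ^ p ^ (m - 2)`, `y ^ p ^ (n - 1)` and `K` generate an elementary abelian group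
    obtain ⟨z, hz, hz1⟩ : ∃ z ∈ K, z ≠ 1 := by
      have : K ≠ ⊥ := by
        rintro h0
        rw [h0, Subgroup.card_bot] at hKcard
        exact hp.one_lt.ne hKcard
      exact (Subgroup.ne_bot_iff_exists_ne_one.1 this).elim fun a ha =>
        ⟨a, a.2, by simpa using ha⟩
    set h' := h ^ p ^ (m - 2) with hh'
    set y' := y ^ p ^ (n - 1) with hy'
    have hzh : Commute z h' := (hcentral z hz h').symm
    have hzy : Commute z y' := (hcentral z hz y').symm
    have hpm : p ^ (m - 1) = p ^ (m - 2) * p := by rw [← pow_succ]; congr 1; omega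
    have hpn : p ^ n = p ^ (n - 1) * p := by rw [← pow_succ]; congr 1; omega
    have hhy : Commute h' y' := by
      refine (Commute.pow_left ?_ _).symm
      -- As `m ≥ 3`, the exponent `p^(m-2)` kills `u`; and `lv ≡ 1` modulo `p`, while `h'` has order
      -- dividing `p`.
      have h1 : y * h' * y⁻¹ = h' := by
        rw [hh', ← conj_pow, hyu, (hcentral u hu _).symm.mul_pow]
        have h2 : u ^ p ^ (m - 2) = 1 := by
          rw [show m - 2 = m - 3 + 1 by omega, pow_succ', pow_mul, hKp u hu, one_pow]
        have h3 : lv ≡ 1 [MOD p] := by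
          rw [← ZMod.natCast_eq_natCast_iff, Nat.cast_one,
            ← castHom_eq_one_of_orderOf hp (by omega) hl,
            ← map_natCast (ZMod.castHom (dvd_pow_self p (by omega : m ≠ 0)) (ZMod p)), hlv,
            ZMod.natCast_zmod_val]
        rw [h2, one_mul, ← pow_mul]
        refine pow_eq_pow_iff_modEq.2 (Nat.ModEq.of_dvd (orderOf_dvd_of_pow_eq_one hcase) ?_)
        have := h3.mul_right' (p ^ (m - 2))
        rwa [one_mul, mul_comm p, ← hpm] at this
      exact mul_inv_eq_iff_eq_mul.1 h1
    have hh'c : c h' = 0 := by rw [hcpow, hhc, mul_zero]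
    have hh'b : b h' = (p ^ (m - 2) : ℕ) := by rw [hbpow h hhc, hhb, mul_one]
    have hy'c : c y' = (p ^ (n - 1) : ℕ) := by rw [hcpow, hyc, mul_one]
    -- These `p^3` products are distinct: `c` detects the exponent of `y'`, `b` that of `h'`, and
    -- the order of `z` the last one.
    let F : Fin p × Fin p × Fin p → G := fun t =>
      z ^ (t.1 : ℕ) * (h' ^ (t.2.1 : ℕ) * y' ^ (t.2.2 : ℕ))
    have hFc : ∀ t, c (F t) = (t.2.2 * p ^ (n - 1) : ℕ) := fun t => by
      simp only [F]
      rw [hc, hc, hcpow z, hcpow h', hcpow y', hh'c, ((hKmem z).1 hz).1, hy'c]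
      push_cast
      ring
    have hFb : ∀ t, b (F t) = (t.2.1 * p ^ (m - 2) : ℕ) := fun t => by
      simp only [F]
      rw [hb, hb, hcpow z, hcpow h', hbpow _ ((hKmem z).1 hz).1, hbpow _ hh'c, ((hKmem z).1 hz).1,
        ((hKmem z).1 hz).2, hh'c, hh'b, hy', ← pow_mul, hbypow, mul_zero, mul_zero, mul_zero, hL0]
      push_cast
      ring
    have hcast : ∀ (q : ℕ) (i j : Fin p), 0 < q →
        ((i * q : ℕ) : ZMod (q * p)) = (j * q : ℕ) → i = j := by
      intro q i j hq hij
      rw [ZMod.natCast_eq_natCast_iff] at hij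
      have h1 := hij.eq_of_lt_of_lt (by rw [mul_comm]; exact Nat.mul_lt_mul_of_pos_left i.2 hq)
        (by rw [mul_comm]; exact Nat.mul_lt_mul_of_pos_left j.2 hq)
      exact Fin.ext (Nat.eq_of_mul_eq_mul_right hq h1)
    have hFinj : Function.Injective F := by
      intro s t hst
      have h1 : s.2.2 = t.2.2 := by
        have := congrArg c hst
        rw [hFc, hFc] at this
        rw [ZMod.natCast_eq_natCast_iff, hpn, ← ZMod.natCast_eq_natCast_iff] at this
        exact hcast _ _ _ (pow_pos hp.pos _) this
      have h2 : s.2.1 = t.2.1 := by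
        have := congrArg b hst
        rw [hFb, hFb] at this
        rw [ZMod.natCast_eq_natCast_iff, hpm, ← ZMod.natCast_eq_natCast_iff] at this
        exact hcast _ _ _ (pow_pos hp.pos _) this
      have h3 : s.1 = t.1 := by
        simp only [F, h1, h2, mul_left_inj] at hst
        have horder := orderOf_eq_prime (hKp z hz) hz1
        exact Fin.ext (pow_injOn_Iio_orderOf (by simp [horder]) (by simp [horder]) hst)
      exact Prod.ext h3 (Prod.ext h2 h1)
    classical
    have hle := hmeta.card_le_sq hp.pos (Finset.univ.image F) ?_ ?_
    · rw [Finset.card_image_of_injective _ hFinj] at hle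
      simp only [Finset.card_univ, Fintype.card_prod, Fintype.card_fin] at hle
      have h2 := hp.two_le
      have h3 : 0 < p * p := Nat.mul_pos hp.pos hp.pos
      nlinarith
    · intro s hs
      obtain ⟨t, -, rfl⟩ := Finset.mem_image.1 hs
      have e1 : h' ^ p = 1 := by rw [hh', ← pow_mul, ← hpm, hcase]
      have e2 : y' ^ p = 1 := by rw [hy', ← pow_mul, ← hpn, hy]
      simp only [F]
      rw [((hzh.pow_pow _ _).mul_right (hzy.pow_pow _ _)).mul_pow, (hhy.pow_pow _ _).mul_pow,
        pow_right_comm, hKp z hz, pow_right_comm, e1, pow_right_comm, e2]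
      simp
    · intro s hs s' hs'
      obtain ⟨t, -, rfl⟩ := Finset.mem_image.1 hs
      obtain ⟨t', -, rfl⟩ := Finset.mem_image.1 hs'
      simp only [F]
      have a1 := (Commute.refl z).pow_pow t.1 t'.1
      have a2 := hzh.pow_pow t.1 t'.2.1
      have a3 := hzy.pow_pow t.1 t'.2.2
      have b1 := hzh.symm.pow_pow t.2.1 t'.1
      have b2 := (Commute.refl h').pow_pow t.2.1 t'.2.1
      have b3 := hhy.pow_pow t.2.1 t'.2.2
      have c1 := hzy.symm.pow_pow t.2.2 t'.1
      have c2 := hhy.symm.pow_pow t.2.2 t'.2.1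
      have c3 := (Commute.refl y').pow_pow t.2.2 t'.2.2
      exact (a1.mul_right (a2.mul_right a3)).mul_left
        ((b1.mul_right (b2.mul_right b3)).mul_left (c1.mul_right (c2.mul_right c3)))
  · -- `h` has order `p ^ m`, and `y` would act on `⟨h⟩` with order `p ^ (n + 1)`
    -- Here `h^(p^(m-1))` generates `K`, so `u` is absorbed into the exponent of `h`.
    obtain ⟨k, hk⟩ := hgen _ hq hcase u hu
    have hconj : y * h * y⁻¹ = h ^ (p ^ (m - 1) * k + lv) := by
      rw [hyu, pow_add, pow_mul, hk]
    have h1 := conj_pow_eq_pow_pow hconj (p ^ n)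
    rw [hy, one_mul, inv_one, mul_one] at h1
    have horder : orderOf h = p ^ m := by
      have : m = m - 1 + 1 := by omega
      rw [this]
      refine orderOf_eq_prime_pow hcase ?_
      rw [pow_succ, pow_mul, hKp _ hq]
    have h2 : h ^ 1 = h ^ (p ^ (m - 1) * k + lv) ^ p ^ n := by rw [pow_one, ← h1]
    rw [pow_eq_pow_iff_modEq, horder, ← ZMod.natCast_eq_natCast_iff] at h2
    -- The exponent is known only modulo `p^(m-1)`, but its `p`-th power is then known modulo `p^m`;
    -- this is where `n ≥ 1` enters.
    have h3 : (((p ^ (m - 1) * k + lv : ℕ) : ZMod (p ^ m))) ^ p = (l : ZMod (p ^ m)) ^ p := by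
      refine ZMod.pow_prime_eq_of_castHom_eq (by omega) ?_
      rw [map_natCast, Nat.cast_add, Nat.cast_mul, ZMod.natCast_self, zero_mul, zero_add]
      exact hlvR
    rw [Nat.cast_pow, show p ^ n = p * p ^ (n - 1) by rw [← pow_succ']; congr 1; omega, pow_mul,
      h3, ← pow_mul, ← pow_succ', Nat.sub_add_cancel hn, Nat.cast_one] at h2
    have h4 : l ^ p ^ n = 1 := Units.ext (by push_cast; exact h2.symm)
    have h5 := orderOf_dvd_of_pow_eq_one h4
    rw [hl, Nat.pow_dvd_pow_iff_le_right hp.one_lt] at h5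
    omega

/-! ### Arithmetic of `λ` and the layered structure of the graph -/

theorem orderOf_pow_eq_one {p m N : ℕ} {l : (ZMod (p ^ m))ˣ} (hl : orderOf l = p ^ N) :
    (l : ZMod (p ^ m)) ^ p ^ N = 1 := by
  rw [← hl, ← Units.val_pow_eq_pow_val, pow_orderOf_eq_one, Units.val_one]

/-- By lifting the exponent for odd `p`, raising `λ^(p^n)` to the `p`-th power increases the
valuation of its difference from `1` by exactly one. -/
theorem reduction_pow_eq_one {p m n : ℕ} (hp : p.Prime) (hp2 : p ≠ 2) (hm : 1 ≤ m)
    {l : (ZMod (p ^ m))ˣ} (hl : orderOf l = p ^ (n + 1)) :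
    reduction p m l ^ p ^ n = 1 := by
  have h1 := castHom_eq_one_of_orderOf hp hm hl
  have h2 := orderOf_pow_eq_one hl
  obtain ⟨a, ha⟩ := ZMod.intCast_surjective (l : ZMod (p ^ m))
  rw [← ha, map_intCast] at h1 ⊢
  rw [← ha] at h2
  have hdvd : (p : ℤ) ∣ a ^ p ^ n - 1 := by
    rw [← ZMod.intCast_zmod_eq_zero_iff_dvd]
    push_cast
    rw [h1, one_pow, sub_self]
  have hndvd : ¬ (p : ℤ) ∣ a ^ p ^ n := fun h => by
    have h3 := dvd_sub h hdvd
    rw [sub_sub_cancel] at h3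
    exact hp.one_lt.ne' (by exact_mod_cast Int.eq_one_of_dvd_one (by positivity) h3)
  have h3 : ((p ^ m : ℕ) : ℤ) ∣ (a ^ p ^ n) ^ p - 1 ^ p := by
    rw [← ZMod.intCast_zmod_eq_zero_iff_dvd]
    push_cast
    rw [← pow_mul, ← pow_succ, h2, one_pow, sub_self]
  have h4 := Int.emultiplicity_pow_sub_pow hp (hp.odd_of_ne_two hp2) hdvd hndvd p
  have h5 : emultiplicity p p = 1 := by
    have := (Nat.finiteMultiplicity_iff (a := p) (b := p)).2 ⟨hp.ne_one, hp.pos⟩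
    rw [this.emultiplicity_self]
  rw [h5] at h4
  have h6 : ((p ^ (m - 1) : ℕ) : ℤ) ∣ a ^ p ^ n - 1 := by
    push_cast at h3 ⊢
    rw [pow_dvd_iff_le_emultiplicity] at h3 ⊢
    rw [h4, show m = m - 1 + 1 by omega, Nat.cast_add, Nat.cast_one] at h3
    exact (ENat.add_le_add_iff_right ENat.one_ne_top).1 h3
  rw [← ZMod.intCast_zmod_eq_zero_iff_dvd] at h6
  push_cast at h6
  exact sub_eq_zero.1 h6

/-- Otherwise `l^p = 1`, whereas the order of `l` is at least `p^2`. -/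
theorem reduction_ne_one {p m n : ℕ} (hp : p.Prime) (hm : 2 ≤ m) (hn : 1 ≤ n)
    {l : (ZMod (p ^ m))ˣ} (hl : orderOf l = p ^ (n + 1)) : reduction p m l ≠ 1 := fun h => by
  have h1 : (l : ZMod (p ^ m)) ^ p = 1 ^ p :=
    ZMod.pow_prime_eq_of_castHom_eq hm (by rw [map_one]; exact h)
  have h2 : l ^ p ^ 1 = 1 := Units.ext (by push_cast; rw [pow_one, h1, one_pow])
  have h3 := orderOf_dvd_of_pow_eq_one h2
  rw [hl, Nat.pow_dvd_pow_iff_le_right hp.one_lt] at h3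
  omega

theorem reduction_ne_neg_one {p m n : ℕ} (hp : p.Prime) (hp2 : p ≠ 2) (hm : 2 ≤ m)
    {l : (ZMod (p ^ m))ˣ} (hl : orderOf l = p ^ (n + 1)) : reduction p m l ≠ -1 := fun h => by
  have := Fact.mk hp
  have h1 := castHom_eq_one_of_orderOf hp (by omega) hl
  have hdvd : p ∣ p ^ (m - 1) := dvd_pow_self p (by omega)
  have h2 := congrArg (ZMod.castHom hdvd (ZMod p)) h
  rw [map_neg, map_one, ← RingHom.comp_apply, RingHom.ext_zmod ((ZMod.castHom hdvd (ZMod p)).comp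
    (reduction p m)) (ZMod.castHom (dvd_pow_self p (by omega)) (ZMod p)), h1] at h2
  have : NeZero (2 : ZMod p) := ⟨fun h0 => hp2 ((Nat.prime_dvd_prime_iff_eq hp Nat.prime_two).1
    ((ZMod.natCast_eq_zero_iff 2 p).1 (by exact_mod_cast h0)))⟩
  exact two_ne_zero (α := ZMod p) (by linear_combination h2)

/-- The image in `ℤ/p^(m-1)` of the slope `l ^ i` of the edges in layer `i`. -/
def slope (p m n : ℕ) (l : (ZMod (p ^ m))ˣ) (i : ZMod (p ^ n)) : ZMod (p ^ (m - 1)) :=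
  reduction p m l ^ i.val

theorem slope_zero (p m n : ℕ) (l : (ZMod (p ^ m))ˣ) : slope p m n l 0 = 1 := by
  simp [slope]

/-- Wrapping around the `p^n` layers is harmless only after reduction, since `l` itself has order
`p^(n+1)`. -/
theorem slope_add {p m n : ℕ} (hp : p.Prime) (hp2 : p ≠ 2) (hm : 1 ≤ m)
    {l : (ZMod (p ^ m))ˣ} (hl : orderOf l = p ^ (n + 1)) (i j : ZMod (p ^ n)) :
    slope p m n l (i + j) = slope p m n l i * slope p m n l j := by
  have : NeZero (p ^ n) := ⟨pow_ne_zero _ hp.ne_zero⟩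
  rw [slope, slope, slope, ZMod.val_add, ← pow_eq_pow_mod _ (reduction_pow_eq_one hp hp2 hm hl),
    pow_add]

theorem slope_one {p m n : ℕ} (hp : p.Prime) (hn : 1 ≤ n) (l : (ZMod (p ^ m))ˣ) :
    slope p m n l 1 = reduction p m l := by
  have : Fact (1 < p ^ n) := ⟨Nat.one_lt_pow (by omega) hp.one_lt⟩
  rw [slope, ZMod.val_one, pow_one]

theorem isUnit_two_zmod {p k : ℕ} (hp : p.Prime) (hp2 : p ≠ 2) : IsUnit (2 : ZMod (p ^ k)) := by
  have h : Nat.Coprime 2 (p ^ k) :=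
    (Nat.coprime_primes Nat.prime_two hp |>.2 hp2.symm).pow_right k
  exact_mod_cast (ZMod.isUnit_iff_coprime 2 (p ^ k)).2 h

theorem isRigid_slope {p m n : ℕ} (hp : p.Prime) (hp2 : p ≠ 2) (hmn : n + 2 ≤ m) (hn : 1 ≤ n)
    {l : (ZMod (p ^ m))ˣ} (hl : orderOf l = p ^ (n + 1)) :
    IsRigid (reduction p m) (slope p m n l) where
  natCast_A a := by
    have : NeZero (p ^ m) := ⟨pow_ne_zero _ hp.ne_zero⟩
    exact ⟨a.val, ZMod.natCast_zmod_val a⟩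
  natCast_I a := by
    have : NeZero (p ^ n) := ⟨pow_ne_zero _ hp.ne_zero⟩
    exact ⟨a.val, ZMod.natCast_zmod_val a⟩
  ker_ne_bot := by
    refine ⟨(p ^ (m - 1) : ℕ), fun h => ?_, by rw [map_natCast, ZMod.natCast_self]⟩
    rw [ZMod.natCast_eq_zero_iff, Nat.pow_dvd_pow_iff_le_right hp.one_lt] at h
    omega
  two_R := isUnit_two_zmod hp hp2
  two_I := isUnit_two_zmod hp hp2
  nontrivial_R := by
    have : Fact (1 < p ^ (m - 1)) := ⟨Nat.one_lt_pow (by omega) hp.one_lt⟩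
    infer_instance
  nontrivial_I := by
    have : Fact (1 < p ^ n) := ⟨Nat.one_lt_pow (by omega) hp.one_lt⟩
    infer_instance
  exists_lift i := ⟨l ^ i.val, l.isUnit.pow _, by rw [map_pow, slope]⟩
  L_zero := slope_zero p m n l
  L_add := slope_add hp hp2 (by omega) hl
  L_one_ne := by
    rw [slope_one hp hn]
    exact reduction_ne_one hp (by omega) hn hl
  L_one_ne' := by
    rw [slope_one hp hn]
    exact reduction_ne_neg_one hp hp2 (by omega) hl

theorem exists_eq_of_reduction_eq_zero {p m : ℕ} (hp : p.Prime) {x : ZMod (p ^ m)}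
    (hx : reduction p m x = 0) :
    ∃ k < p ^ m / p ^ (m - 1), x = ((k * p ^ (m - 1) : ℕ) : ZMod (p ^ m)) := by
  have : NeZero (p ^ m) := ⟨pow_ne_zero _ hp.ne_zero⟩
  have hq : 0 < p ^ (m - 1) := pow_pos hp.pos _
  rw [← ZMod.natCast_zmod_val x, map_natCast, ZMod.natCast_eq_zero_iff] at hx
  refine ⟨x.val / p ^ (m - 1), ?_, ?_⟩
  · exact Nat.div_lt_div_of_lt_of_dvd (pow_dvd_pow p (Nat.sub_le m 1)) x.val_lt
  · rw [Nat.div_mul_cancel hx, ZMod.natCast_zmod_val]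

theorem isLayered_graph {p m n : ℕ} (hp : p.Prime) (hp2 : p ≠ 2) (hmn : n + 2 ≤ m) (hn : 1 ≤ n)
    {l : (ZMod (p ^ m))ˣ} (hl : orderOf l = p ^ (n + 1)) :
    IsLayered (graph (p ^ m) (p ^ n) (p ^ (m - 1)) l) (reduction p m) (slope p m n l) := by
  have H := isRigid_slope hp hp2 hmn hn hl
  have hd : ∀ k : ℕ, reduction p m ((k * p ^ (m - 1) : ℕ) : ZMod (p ^ m)) = 0 := fun k => by
    rw [map_natCast, Nat.cast_mul, ZMod.natCast_self, mul_zero]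
  have hedge : ∀ (a b : ZMod (p ^ m)) (i : ZMod (p ^ n)),
      reduction p m b - reduction p m a = slope p m n l i →
      s((a, i), (b, i)) ∈ layerEdges (p ^ m) (p ^ n) (p ^ (m - 1)) l i := by
    intro a b i hab
    obtain ⟨k, hk, hx⟩ := exists_eq_of_reduction_eq_zero hp
      (x := b - a - (l : ZMod (p ^ m)) ^ i.val) (by
        rw [map_sub, map_sub, hab, map_pow, slope, sub_self])
    refine ⟨a, k, hk, Or.inl ?_⟩
    rw [← hx]
    congr 3
    ring
  intro u v
  rw [graph, SimpleGraph.fromEdgeSet_adj]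
  constructor
  · rintro ⟨h, -⟩
    obtain ⟨i, h⟩ := Set.mem_iUnion.1 h
    have hdl : ∀ i : ZMod (p ^ n), reduction p m ((l : ZMod (p ^ m)) ^ i.val) = slope p m n l i :=
      fun i => map_pow _ _ _
    rcases h with ⟨j, k, -, h | h⟩ | ⟨j, h⟩ <;> rw [Sym2.eq_iff] at h
    · left
      rcases h with ⟨rfl, rfl⟩ | ⟨rfl, rfl⟩ <;> simp only [LayerAdj, map_add, hd, hdl] <;> simp
    · left
      rcases h with ⟨rfl, rfl⟩ | ⟨rfl, rfl⟩ <;> simp only [LayerAdj, map_sub, hd, hdl] <;> simp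
    · right
      rcases h with ⟨rfl, rfl⟩ | ⟨rfl, rfl⟩ <;> simp [SpokeAdj]
  · obtain ⟨a, i⟩ := u
    obtain ⟨b, j⟩ := v
    rintro (⟨h1, h2⟩ | ⟨h1, h2⟩) <;> dsimp only at h1 h2 <;> subst h1
    · refine ⟨Set.mem_iUnion.2 ⟨i, Or.inl ?_⟩, ?_⟩
      · rcases h2 with h2 | h2
        · exact hedge a b i h2
        · rw [Sym2.eq_swap]
          exact hedge b a i h2
      · rintro h
        rw [Prod.mk.injEq] at h
        have := H.L_ne_zero i
        rw [h.1, sub_self] at h2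
        tauto
    · have := H.one_ne_zero_I
      rcases h2 with rfl | rfl
      · exact ⟨Set.mem_iUnion.2 ⟨i, Or.inr ⟨a, rfl⟩⟩, by simpa using this⟩
      · exact ⟨Set.mem_iUnion.2 ⟨j, Or.inr ⟨a, Sym2.eq_swap⟩⟩, by simpa using this⟩

end MultilayerPetersen

/-! ### Cayley graphs and regular actions -/

namespace SimpleGraph

/-- A group acts on each of its Cayley graphs by left multiplication. -/
def mulCayleyLeftMul {G : Type*} [Group G] (S : Set G) : G →* (mulCayley S ≃g mulCayley S) where
  toFun g := ⟨Equiv.mulLeft g, by simp⟩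
  map_one' := RelIso.ext fun x => one_mul x
  map_mul' g h := RelIso.ext fun x => mul_assoc g h x

/-- The regular action of `G` on a Cayley graph of `G`. -/
theorem IsCayleyGraphOf.exists_regular {V G : Type*} [Group G] {Γ : SimpleGraph V}
    (h : Γ.IsCayleyGraphOf G) :
    ∃ ρ : G →* (Γ ≃g Γ), ∀ v : V, Function.Bijective fun g => ρ g v := by
  obtain ⟨S, -, -, ⟨e⟩⟩ := h
  refine ⟨⟨⟨fun g => e.trans ((mulCayleyLeftMul S g).trans e.symm), ?_⟩, ?_⟩, fun v => ⟨?_, ?_⟩⟩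
  · ext v
    simp [mulCayleyLeftMul]
  · intro g h
    ext v
    simp [mulCayleyLeftMul]
  · intro g h hgh
    simpa [mulCayleyLeftMul] using hgh
  · intro w
    exact ⟨e w * (e v)⁻¹, by simp [mulCayleyLeftMul]⟩

/-- A graph with a regular group of automorphisms is a Cayley graph of that group. -/
theorem IsCayleyGraphOf.of_bijective {V G : Type*} [Group G] {Γ : SimpleGraph V}
    (ρ : G →* (Γ ≃g Γ)) (v : V) (h : Function.Bijective fun g => ρ g v) :
    Γ.IsCayleyGraphOf G := by
  have hadj : ∀ g a b, Γ.Adj (ρ g a) (ρ g b) ↔ Γ.Adj a b := fun g a b => (ρ g).map_adj_iff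
  have hone : ρ 1 v = v := by rw [map_one]; rfl
  have hsymm : ∀ s, Γ.Adj v (ρ s v) → Γ.Adj v (ρ s⁻¹ v) := fun s hs => by
    rw [← hadj s, ← RelIso.mul_apply, ← map_mul, mul_inv_cancel, hone]
    exact hs.symm
  refine ⟨{g | Γ.Adj v (ρ g v)}, fun h1 => ?_, hsymm, ⟨RelIso.symm ⟨Equiv.ofBijective _ h, ?_⟩⟩⟩
  · rw [Set.mem_ofPred_eq, hone] at h1
    exact Γ.irrefl h1
  · intro a b
    rw [mulCayley_adj']
    simp only [Equiv.ofBijective_apply]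
    have key : ∀ a s, Γ.Adj (ρ a v) (ρ (a * s) v) ↔ Γ.Adj v (ρ s v) := fun a s => by
      rw [map_mul, RelIso.mul_apply, hadj]
    constructor
    · intro hab
      refine ⟨fun h => Γ.irrefl (h ▸ hab), a⁻¹ * b, ?_, Or.inl (by group)⟩
      rw [Set.mem_ofPred_eq, ← key a, mul_inv_cancel_left]
      exact hab
    · rintro ⟨-, s, hs, rfl | rfl⟩
      · exact (key a s).2 hs
      · exact ((key b s).2 hs).symm

end SimpleGraph

namespace MultilayerPetersen

theorem card_ker_reduction {p m : ℕ} (hp : p.Prime) (hm : 1 ≤ m) :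
    Nat.card (reduction p m).toAddMonoidHom.ker = p := by
  have h1 := (reduction p m).toAddMonoidHom.ker.card_mul_index
  rw [AddSubgroup.index_ker, AddMonoidHom.range_eq_top.2
    (ZMod.castHom_surjective (pow_dvd_pow p (Nat.sub_le m 1)) : Function.Surjective (reduction p m)),
    AddSubgroup.card_top, Nat.card_zmod, Nat.card_zmod] at h1
  refine Nat.eq_of_mul_eq_mul_right (pow_pos hp.pos (m - 1)) (h1.trans ?_)
  rw [← pow_succ', Nat.sub_add_cancel hm]

theorem not_isCayleyGraphOf_of_isMetacyclic {p m n : ℕ} (hp : p.Prime) (hp2 : p ≠ 2)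
    (hmn : n + 2 ≤ m) (hn : 1 ≤ n) {l : (ZMod (p ^ m))ˣ} (hl : orderOf l = p ^ (n + 1))
    {G : Type*} [Group G] (hG : IsMetacyclic G) :
    ¬ (graph (p ^ m) (p ^ n) (p ^ (m - 1)) l).IsCayleyGraphOf G := by
  intro hcay
  have H := isRigid_slope hp hp2 hmn hn hl
  have hΓ := isLayered_graph hp hp2 hmn hn hl
  obtain ⟨ρ, hρ⟩ := hcay.exists_regular
  have : NeZero (p ^ m) := ⟨pow_ne_zero _ hp.ne_zero⟩
  have : NeZero (p ^ n) := ⟨pow_ne_zero _ hp.ne_zero⟩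
  let E : G ≃ ZMod (p ^ m) × ZMod (p ^ n) := Equiv.ofBijective _ (hρ (0, 0))
  have hfin : Finite G := Finite.of_equiv _ E.symm
  have hcardG : Nat.card G = p ^ (m + n) := by
    rw [Nat.card_congr E, Nat.card_prod, Nat.card_zmod, Nat.card_zmod, pow_add]
  -- The order of `G` is odd, so every element is a fourth power and its affine slope carries no
  -- sign.
  have hcop : (Nat.card G).Coprime 4 := by
    rw [hcardG]
    have := (Nat.coprime_primes hp Nat.prime_two).2 hp2
    exact (Nat.Coprime.pow (m + n) 2 this)
  have haff : ∀ g : G, ∃ (φ : ZMod (p ^ m) → ZMod (p ^ m)) (c : ZMod (p ^ n))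
      (b : ZMod (p ^ (m - 1))), (∀ a i, ρ g (a, i) = (φ a, i + c)) ∧
      ∀ a, reduction p m (φ a) = slope p m n l c * reduction p m a + b := by
    intro g
    obtain ⟨g', rfl⟩ := (powCoprime hcop).surjective g
    obtain ⟨φ, c, b, h1, h2⟩ := exists_affine_pow_four H hΓ (ρ g')
    refine ⟨φ, c, b, fun a i => ?_, h2⟩
    rw [powCoprime_apply, map_pow, h1]
  choose φ c b h1 h2 using haff
  have hmul : ∀ g h a i, ρ (g * h) (a, i) = (φ g (φ h a), i + c h + c g) := fun g h a i => by
    rw [map_mul, RelIso.mul_apply, h1 h, h1 g]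
  have hb : ∀ g, b g = reduction p m (φ g 0) := fun g => by rw [h2, map_zero, mul_zero, zero_add]
  have hcmul : ∀ g h, c (g * h) = c g + c h := fun g h => by
    have := congrArg Prod.snd (hmul g h 0 0)
    rw [h1] at this
    simpa [add_comm] using this
  have hbmul : ∀ g h, b (g * h) = slope p m n l (c g) * b h + b g := fun g h => by
    have := congrArg Prod.fst (hmul g h 0 0)
    rw [h1] at this
    rw [hb (g * h), show φ (g * h) 0 = φ g (φ h 0) from this, h2, ← hb]
  obtain ⟨h, hh⟩ := (hρ (0, 0)).2 (1, 0)
  obtain ⟨y, hy⟩ := (hρ (0, 0)).2 (0, 1)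
  simp only [h1, zero_add, Prod.mk.injEq] at hh hy
  refine not_isMetacyclic_of_cocycle hp hmn hn hl ⟨_, hcardG⟩ c b (slope p m n l)
    (slope_zero p m n l) (slope_one hp hn l) hcmul hbmul (h := h) (y := y) hh.2
    (by rw [hb, hh.1, map_one]) hy.2 (by rw [hb, hy.1, map_zero]) ?_ ?_ hG
  · have hpow : ∀ k : ℕ, ρ (y ^ k) (0, 0) = (0, (k : ZMod (p ^ n))) := fun k => by
      induction k with
      | zero => simp
      | succ k ih =>
        rw [pow_succ', map_mul, RelIso.mul_apply, ih, h1, hy.1, hy.2]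
        push_cast
        rfl
    refine (hρ (0, 0)).1 ?_
    simp only [hpow, map_one, ZMod.natCast_self, RelIso.one_apply]
  -- By regularity, evaluation at the origin matches the kernel of the cocycle pair with the kernel
  -- of the reduction, inside layer `0`.
  · refine Eq.trans ?_ (card_ker_reduction hp (show 1 ≤ m by omega))
    refine Nat.card_congr (Equiv.ofBijective
      (fun g => ⟨φ g.1 0, by
        have := g.2.2
        rw [hb] at this
        exact this⟩) ⟨?_, ?_⟩)
    · rintro ⟨g, hg, hg'⟩ ⟨g', hgg, hgg'⟩ heq
      refine Subtype.ext ((hρ (0, 0)).1 ?_)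
      simp only [h1, hg, hgg]
      rw [show φ g 0 = φ g' 0 from congrArg Subtype.val heq]
    · rintro ⟨a, ha⟩
      obtain ⟨g, hg⟩ := (hρ (0, 0)).2 (a, 0)
      simp only [h1, zero_add, Prod.mk.injEq] at hg
      exact ⟨⟨g, hg.2, by rw [hb, hg.1]; exact ha⟩, Subtype.ext hg.1⟩

end MultilayerPetersen

/-! ### The metacirculant structure -/

/-- The subgroup `⟨s⟩` is normalized by both generators, and the quotient is generated by the image
of `t`. -/
theorem isMetacyclic_closure_pair {G : Type*} [Group G] {s t : G}
    (h : ∀ g, g ∈ Subgroup.zpowers s ↔ t * g * t⁻¹ ∈ Subgroup.zpowers s) :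
    IsMetacyclic (Subgroup.closure {s, t}) := by
  set X := Subgroup.closure {s, t} with hX
  have hs : s ∈ X := Subgroup.subset_closure (by simp)
  have ht : t ∈ X := Subgroup.subset_closure (by simp)
  have hle : X ≤ Subgroup.normalizer (Subgroup.zpowers s) := by
    rw [hX, Subgroup.closure_le]
    rintro g (rfl | rfl)
    · exact Subgroup.le_normalizer (Subgroup.mem_zpowers g)
    · exact Subgroup.mem_normalizer_iff.2 h
  have hN := Subgroup.normal_subgroupOf_of_le_normalizer hle
  refine ⟨(Subgroup.zpowers s).subgroupOf X, hN, ?_, ?_⟩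
  · exact isCyclic_of_surjective _
      (Subgroup.subgroupOfEquivOfLe ((Subgroup.zpowers_le).2 hs)).symm.surjective
  · let f := QuotientGroup.mk' ((Subgroup.zpowers s).subgroupOf X)
    have htop : (Subgroup.zpowers (f ⟨t, ht⟩)).comap f = ⊤ := by
      rw [eq_top_iff, ← Subgroup.closure_closure_coe_preimage, Subgroup.closure_le]
      intro g hg
      rw [SetLike.mem_coe, Subgroup.mem_comap]
      rcases hg with hg | hg
      · have : f g = 1 :=
          (QuotientGroup.eq_one_iff _).2 (Subgroup.mem_subgroupOf.2 (hg ▸ Subgroup.mem_zpowers s))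
        rw [this]
        exact one_mem _
      · rw [show g = ⟨t, ht⟩ from Subtype.ext hg]
        exact Subgroup.mem_zpowers _
    refine ⟨f ⟨t, ht⟩, fun q => ?_⟩
    obtain ⟨g, rfl⟩ := QuotientGroup.mk'_surjective _ q
    exact Subgroup.mem_comap.1 (htop ▸ Subgroup.mem_top g)

theorem SimpleGraph.IsMetacirculant.isWeakMetacirculant {V : Type*} {Γ : SimpleGraph V}
    (h : Γ.IsMetacirculant) : Γ.IsWeakMetacirculant := by
  obtain ⟨m, n, -, -, -, σ, τ, -, -, hnorm, htrans, -⟩ := h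
  refine ⟨_, isMetacyclic_closure_pair hnorm, fun u v => ?_⟩
  obtain ⟨k, g, hg, hguv⟩ := htrans u v
  refine ⟨g * τ ^ k, mul_mem ?_ (pow_mem (Subgroup.subset_closure (by simp)) k), hguv⟩
  exact (Subgroup.zpowers_le.2 (Subgroup.subset_closure (by simp))) hg

namespace MultilayerPetersen

section Automorphisms

variable {A R I : Type*} [CommRing A] [CommRing R] [CommRing I] {d : A →+* R} {L : I → R}
  {Γ : SimpleGraph (A × I)}

/-- The automorphism of a layered graph that shifts the layers by `c` and acts on `A` by `α`, where
`α` induces an affine map of slope `L c` on `R`. -/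
def affineAut (H : IsRigid d L) (hΓ : IsLayered Γ d L) (α : A ≃ A) (c : I) (b : R)
    (hα : ∀ a, d (α a) = L c * d a + b) : Γ ≃g Γ where
  toEquiv := α.prodCongr (Equiv.addRight c)
  map_rel_iff' := by
    rintro ⟨a, i⟩ ⟨a', i'⟩
    have hcancel : ∀ x y, L c * x - L c * y = L c * L i ↔ x - y = L i := fun x y => by
      rw [← mul_sub]
      exact (H.isUnit_L c).mul_right_inj
    rw [hΓ, hΓ]
    simp only [LayerAdj, SpokeAdj, Equiv.prodCongr_apply, Prod.map_apply, Equiv.coe_addRight, hα,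
      add_left_inj, EmbeddingLike.apply_eq_iff_eq, add_sub_add_right_eq_sub, add_right_comm _ c 1]
    rw [add_comm i c, H.L_add, hcancel, hcancel]

@[simp]
theorem affineAut_apply (H : IsRigid d L) (hΓ : IsLayered Γ d L) (α : A ≃ A) (c : I) (b : R)
    (hα : ∀ a, d (α a) = L c * d a + b) (v : A × I) :
    affineAut H hΓ α c b hα v = (α v.1, v.2 + c) := rfl

/-- The translations of `A` as automorphisms of a layered graph. -/
def translation (H : IsRigid d L) (hΓ : IsLayered Γ d L) : Multiplicative A →* (Γ ≃g Γ) where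
  toFun a := affineAut H hΓ (Equiv.addRight a.toAdd) 0 (d a.toAdd) (by simp [H.L_zero])
  map_one' := by ext v <;> simp
  map_mul' a b := by ext v <;> simp [add_comm, add_left_comm]

theorem translation_apply (H : IsRigid d L) (hΓ : IsLayered Γ d L) (a : A) (v : A × I) :
    translation H hΓ (Multiplicative.ofAdd a) v = (v.1 + a, v.2) := by
  simp [translation]

theorem mem_zpowers_translation (H : IsRigid d L) (hΓ : IsLayered Γ d L) (g : Γ ≃g Γ) :
    g ∈ Subgroup.zpowers (translation H hΓ (Multiplicative.ofAdd 1)) ↔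
      ∃ a : A, translation H hΓ (Multiplicative.ofAdd a) = g := by
  constructor
  · rintro ⟨k, rfl⟩
    refine ⟨k • (1 : A), ?_⟩
    rw [ofAdd_zsmul, map_zpow]
  · rintro ⟨a, rfl⟩
    obtain ⟨k, rfl⟩ := H.natCast_A a
    refine ⟨k, ?_⟩
    dsimp only
    rw [zpow_natCast, ← map_pow, ← ofAdd_nsmul, nsmul_one]

end Automorphisms

/-- Here `σ` is translation by `1` and `τ` multiplies by `l` while raising the layer. As `τ` fixes
the position `0`, the origin has a cycle of length `p^n`, although `τ` has order `p^(n+1)`. -/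
theorem isMetacirculant_graph {p m n : ℕ} (hp : p.Prime) (hp2 : p ≠ 2) (hmn : n + 2 ≤ m)
    (hn : 1 ≤ n) {l : (ZMod (p ^ m))ˣ} (hl : orderOf l = p ^ (n + 1)) :
    (graph (p ^ m) (p ^ n) (p ^ (m - 1)) l).IsMetacirculant := by
  have H := isRigid_slope hp hp2 hmn hn hl
  have hΓ := isLayered_graph hp hp2 hmn hn hl
  have : NeZero (p ^ n) := ⟨pow_ne_zero _ hp.ne_zero⟩
  let T := translation H hΓ
  let τ := affineAut H hΓ (Units.mulLeft l) 1 0 (fun a => by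
    rw [slope_one hp hn, Units.mulLeft_apply, map_mul, add_zero])
  have hτ : ∀ v, τ v = (l * v.1, v.2 + 1) := fun v => rfl
  have hT : ∀ a v, T (Multiplicative.ofAdd a) v = (v.1 + a, v.2) := translation_apply H hΓ
  have hτT : ∀ a, τ * T (Multiplicative.ofAdd a) = T (Multiplicative.ofAdd (l * a)) * τ :=
    fun a => by ext v <;> simp [hτ, hT, mul_add]
  have hτpow : ∀ (k : ℕ) v, (τ ^ k) v = ((l : ZMod (p ^ m)) ^ k * v.1, v.2 + k) := fun k v => by
    induction k with
    | zero => simp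
    | succ k ih =>
      rw [pow_succ', RelIso.mul_apply, ih, hτ, pow_succ', mul_assoc, add_assoc, Nat.cast_succ]
  refine ⟨p ^ n, p ^ m, Nat.one_le_pow _ _ hp.pos,
    hp.two_le.trans (Nat.le_self_pow (by omega) p), ?_, T (Multiplicative.ofAdd 1), τ, ?_, ?_, ?_,
    ?_, (0, 0), ?_⟩
  · rw [Nat.card_prod, Nat.card_zmod, Nat.card_zmod, mul_comm]
  · have hinj : Function.Injective T := fun a b hab => by
      have := congrArg (fun f : graph (p ^ m) (p ^ n) (p ^ (m - 1)) l ≃g _ => (f (0, 0)).1) hab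
      have h : ∀ a : Multiplicative (ZMod (p ^ m)), (T a (0, 0)).1 = a.toAdd := fun a =>
        (congrArg Prod.fst (hT a.toAdd (0, 0))).trans (zero_add _)
      exact Multiplicative.toAdd.injective (((h a).symm.trans this).trans (h b))
    rw [orderOf_injective T hinj, orderOf_ofAdd_eq_addOrderOf, ZMod.addOrderOf_one]
  · intro g hg v hv
    obtain ⟨a, rfl⟩ := (mem_zpowers_translation H hΓ g).1 hg
    have : a = 0 := by
      have := congrArg Prod.fst ((hT a v).symm.trans hv)
      simpa using this
    rw [this, ofAdd_zero, map_one]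
  · intro g
    rw [mem_zpowers_translation, mem_zpowers_translation]
    constructor
    · rintro ⟨a, rfl⟩
      exact ⟨l * a, eq_mul_inv_of_mul_eq (hτT a).symm⟩
    · rintro ⟨a, ha⟩
      refine ⟨(l⁻¹ : (ZMod (p ^ m))ˣ) * a, mul_left_cancel (a := τ) ?_⟩
      change τ * T _ = _
      rw [hτT, Units.mul_inv_cancel_left]
      exact (eq_mul_inv_iff_mul_eq.1 ha)
  · intro u v
    refine ⟨(v.2 - u.2).val,
      T (Multiplicative.ofAdd (v.1 - (l : ZMod (p ^ m)) ^ (v.2 - u.2).val * u.1)),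
      (mem_zpowers_translation H hΓ _).2 ⟨_, rfl⟩, ?_⟩
    rw [hT, hτpow, ZMod.natCast_zmod_val, add_sub_cancel, add_sub_cancel]
  · have hper : ∀ k : ℕ, Function.IsPeriodicPt τ k (0, 0) ↔ p ^ n ∣ k := fun k => by
      have hiter : τ^[k] (0, 0) = (τ ^ k) (0, 0) := by
        clear hτpow
        induction k with
        | zero => rfl
        | succ k ih => rw [Function.iterate_succ_apply', ih, pow_succ', RelIso.mul_apply]
      rw [Function.IsPeriodicPt, Function.IsFixedPt, hiter, hτpow, mul_zero, zero_add,
        Prod.mk.injEq, ZMod.natCast_eq_zero_iff]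
      simp
    exact Nat.dvd_antisymm (((hper _).2 dvd_rfl).minimalPeriod_dvd)
      ((hper _).1 (Function.isPeriodicPt_minimalPeriod _ _))

end MultilayerPetersen

/-! ### The graph as a Cayley graph of `𝒢` -/

/-- Normal forms in a group generated by `x`, `y`, `z` with `x y = y x ^ l` and `z` central. -/
theorem exists_eq_pow_mul_pow_mul_pow {G : Type*} [Group G] {x y z : G} {a b c l : ℕ} (ha : 0 < a)
    (hb : 0 < b) (hc : 0 < c) (hx : x ^ a = 1) (hy : y ^ b = 1) (hz : z ^ c = 1)
    (hxy : x * y = y * x ^ l) (hzx : Commute z x) (hzy : Commute z y)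
    (htop : Subgroup.closure {x, y, z} = ⊤) (g : G) :
    ∃ i j k : ℕ, g = y ^ i * x ^ j * z ^ k := by
  have hxy' : ∀ t, x ^ t * y = y * x ^ (l * t) := fun t => by
    have : SemiconjBy y (x ^ l) x := hxy.symm
    rw [pow_mul]
    exact (this.pow_right t).eq.symm
  have hxyi : ∀ i t : ℕ, ∃ s : ℕ, x ^ t * y ^ i = y ^ i * x ^ s := fun i t => by
    induction i with
    | zero => exact ⟨t, by simp⟩
    | succ i ih =>
      obtain ⟨s, hs⟩ := ih
      exact ⟨l * s, by rw [pow_succ, ← mul_assoc, hs, mul_assoc, hxy', mul_assoc]⟩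
  have hinv : ∀ {w : G} {e : ℕ}, 0 < e → w ^ e = 1 → w⁻¹ = w ^ (e - 1) := fun {w e} he hw =>
    inv_eq_of_mul_eq_one_right (by rw [← pow_succ', Nat.sub_add_cancel he, hw])
  have key : ∀ (w : G), w ∈ ({x, y, z} : Set G) → ∀ (t : ℕ) (g : G),
      (∃ i j k : ℕ, g = y ^ i * x ^ j * z ^ k) →
        ∃ i j k : ℕ, w ^ t * g = y ^ i * x ^ j * z ^ k := by
    rintro w (rfl | rfl | rfl) t g ⟨i, j, k, rfl⟩
    · obtain ⟨s, hs⟩ := hxyi i t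
      exact ⟨i, s + j, k, by rw [pow_add, ← mul_assoc, ← mul_assoc, hs]; group⟩
    · exact ⟨t + i, j, k, by rw [pow_add]; group⟩
    · refine ⟨i, j, t + k, ?_⟩
      rw [pow_add, ← mul_assoc (w ^ t), ← mul_assoc (y ^ i * x ^ j),
        ((hzy.pow_pow t i).mul_right (hzx.pow_pow t j)).eq]
  have hg : g ∈ Subgroup.closure {x, y, z} := htop ▸ Subgroup.mem_top g
  induction hg using Subgroup.closure_induction_left with
  | one => exact ⟨0, 0, 0, by simp⟩
  | mul_left w hw g _ ih => simpa using key w hw 1 g ih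
  | inv_mul_cancel w hw g _ ih =>
    have : ∃ e, w⁻¹ = w ^ e := by
      rcases hw with rfl | rfl | rfl
      exacts [⟨_, hinv ha hx⟩, ⟨_, hinv hb hy⟩, ⟨_, hinv hc hz⟩]
    obtain ⟨e, he⟩ := this
    rw [he]
    exact key w hw e g ih

namespace MultilayerPetersen

/-- Coordinates on `ℤ/p^m` of which the first one is the reduction modulo `p ^ (m - 1)`. -/
theorem exists_coordinates {p m : ℕ} (hp : p.Prime) (hm : 1 ≤ m) :
    ∃ e : ZMod (p ^ m) ≃ ZMod (p ^ (m - 1)) × ZMod p, ∀ a, (e a).1 = reduction p m a := by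
  have : NeZero (p ^ m) := ⟨pow_ne_zero _ hp.ne_zero⟩
  have : NeZero (p ^ (m - 1)) := ⟨pow_ne_zero _ hp.ne_zero⟩
  have : NeZero p := ⟨hp.ne_zero⟩
  have hpm : p ^ (m - 1) * p = p ^ m := by rw [← pow_succ, Nat.sub_add_cancel hm]
  -- The second coordinate is the top base-`p` digit. The bijection need not be additive, since
  -- edges ignore this digit.
  let f : ZMod (p ^ m) → ZMod (p ^ (m - 1)) × ZMod p := fun a =>
    (reduction p m a, (a.val / p ^ (m - 1) : ℕ))
  have hf : Function.Bijective f := by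
    rw [Fintype.bijective_iff_injective_and_card]
    refine ⟨fun a b hab => ?_, by simp [ZMod.card, hpm]⟩
    obtain ⟨h1, h2⟩ := Prod.mk.inj hab
    rw [← ZMod.natCast_zmod_val a, ← ZMod.natCast_zmod_val b, map_natCast, map_natCast,
      ZMod.natCast_eq_natCast_iff] at h1
    rw [ZMod.natCast_eq_natCast_iff] at h2
    have hlt : ∀ a : ZMod (p ^ m), a.val / p ^ (m - 1) < p := fun a =>
      Nat.div_lt_of_lt_mul (a.val_lt.trans_eq hpm.symm)
    have h3 := h2.eq_of_lt_of_lt (hlt a) (hlt b)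
    apply ZMod.val_injective
    rw [← Nat.div_add_mod a.val (p ^ (m - 1)), ← Nat.div_add_mod b.val (p ^ (m - 1)), h3, h1]
  exact ⟨Equiv.ofBijective f hf, fun a => rfl⟩

-- The relations make `X`, `Y`, `Z` an action of the presented group. Normal forms bound the group
-- from above, and the orbit of the origin shows that distinct normal forms act differently and
-- reach every vertex.
open FreeGroup (of) in
theorem isCayleyGraphOf_xyzGroup {p m n : ℕ} (hp : p.Prime) (hp2 : p ≠ 2) (hmn : n + 2 ≤ m)
    (hn : 1 ≤ n) {l : (ZMod (p ^ m))ˣ} (hl : orderOf l = p ^ (n + 1)) :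
    (graph (p ^ m) (p ^ n) (p ^ (m - 1)) l).IsCayleyGraphOf (XYZGroup p m n l) := by
  have H := isRigid_slope hp hp2 hmn hn hl
  have hΓ := isLayered_graph hp hp2 hmn hn hl
  have : NeZero (p ^ m) := ⟨pow_ne_zero _ hp.ne_zero⟩
  have : NeZero (p ^ n) := ⟨pow_ne_zero _ hp.ne_zero⟩
  have : NeZero (p ^ (m - 1)) := ⟨pow_ne_zero _ hp.ne_zero⟩
  have : NeZero p := ⟨hp.ne_zero⟩
  obtain ⟨e, he⟩ := exists_coordinates hp (show 1 ≤ m by omega)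
  set lv := (l : ZMod (p ^ m)).val with hlv
  have hlvR : (lv : ZMod (p ^ (m - 1))) = reduction p m l := by
    rw [← map_natCast (reduction p m), hlv, ZMod.natCast_zmod_val]
  -- `Y` lowers the layer and multiplies by the inverse `μ` of `λ`, so that `X * Y = Y * X ^ lv`, as
  -- the presentation demands.
  set μ := slope p m n l (-1) with hμ
  have hμl : μ * lv = 1 := by
    rw [hlvR, ← slope_one hp hn, hμ, ← H.L_add, neg_add_cancel, H.L_zero]
  have haut : ∀ (β : ZMod (p ^ (m - 1)) × ZMod p ≃ ZMod (p ^ (m - 1)) × ZMod p) (c : ZMod (p ^ n))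
      (b : ZMod (p ^ (m - 1))) (_ : ∀ w, (β w).1 = slope p m n l c * w.1 + b),
      ∃ g : graph (p ^ m) (p ^ n) (p ^ (m - 1)) l ≃g graph (p ^ m) (p ^ n) (p ^ (m - 1)) l,
        ∀ w i, g (e.symm w, i) = (e.symm (β w), i + c) := fun β c b hβ =>
    ⟨affineAut H hΓ (e.trans (β.trans e.symm)) c b (fun a => by
      rw [← he, ← he, ← hβ]
      simp), fun w i => by simp⟩
  obtain ⟨X, hX⟩ := haut (Equiv.addRight (1, 0)) 0 1 (fun w => by simp [H.L_zero])
  obtain ⟨Z, hZ⟩ := haut (Equiv.addRight (0, 1)) 0 0 (fun w => by simp [H.L_zero])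
  obtain ⟨Y, hY⟩ := haut ((Units.mulLeft (H.isUnit_L (-1)).unit).prodCongr (Equiv.refl _)) (-1) 0
    (fun w => by simp)
  replace hX : ∀ r s i, X (e.symm (r, s), i) = (e.symm (r + 1, s), i) := fun r s i => by simp [hX]
  replace hZ : ∀ r s i, Z (e.symm (r, s), i) = (e.symm (r, s + 1), i) := fun r s i => by simp [hZ]
  replace hY : ∀ r s i, Y (e.symm (r, s), i) = (e.symm (μ * r, s), i - 1) := fun r s i => by
    simp [hY, sub_eq_add_neg, hμ]
  have hXpow : ∀ (k : ℕ) r s i, (X ^ k) (e.symm (r, s), i) = (e.symm (r + k, s), i) :=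
    fun k r s i => by
      induction k with
      | zero => simp
      | succ k ih => rw [pow_succ', RelIso.mul_apply, ih, hX, Nat.cast_succ, add_assoc]
  have hZpow : ∀ (k : ℕ) r s i, (Z ^ k) (e.symm (r, s), i) = (e.symm (r, s + k), i) :=
    fun k r s i => by
      induction k with
      | zero => simp
      | succ k ih => rw [pow_succ', RelIso.mul_apply, ih, hZ, Nat.cast_succ, add_assoc]
  have hYpow : ∀ (k : ℕ) r s i, (Y ^ k) (e.symm (r, s), i) = (e.symm (μ ^ k * r, s), i - k) :=
    fun k r s i => by
      induction k with
      | zero => simp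
      | succ k ih =>
        rw [pow_succ', RelIso.mul_apply, ih, hY, Nat.cast_succ, sub_sub, pow_succ', mul_assoc]
  have hext : ∀ f g : graph (p ^ m) (p ^ n) (p ^ (m - 1)) l ≃g graph (p ^ m) (p ^ n) (p ^ (m - 1)) l,
      (∀ r s i, f (e.symm (r, s), i) = g (e.symm (r, s), i)) → f = g := fun f g h =>
    RelIso.ext fun v => by
      obtain ⟨a, i⟩ := v
      simpa using h (e a).1 (e a).2 i
  have hμpow : μ ^ p ^ n = 1 := by
    have h1 : (μ * lv) ^ p ^ n = 1 := by rw [hμl, one_pow]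
    rwa [mul_pow, hlvR, reduction_pow_eq_one hp hp2 (by omega) hl, mul_one] at h1
  have hrel : ∀ r ∈ relators p m n l, FreeGroup.lift ![X, Y, Z] r = 1 := by
    rintro r (rfl | rfl | rfl | rfl | rfl | rfl) <;>
      simp only [map_mul, map_inv, map_pow, FreeGroup.lift_apply_of, Matrix.cons_val]
    · refine hext _ _ fun r s i => ?_
      rw [hXpow, ZMod.natCast_self, add_zero]
      rfl
    · refine hext _ _ fun r s i => ?_
      rw [hYpow, ZMod.natCast_self, sub_zero, hμpow, one_mul]
      rfl
    · refine hext _ _ fun r s i => ?_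
      rw [hZpow, ZMod.natCast_self, add_zero]
      rfl
    · rw [mul_inv_eq_one, mul_assoc, inv_mul_eq_iff_eq_mul]
      refine hext _ _ fun r s i => ?_
      rw [RelIso.mul_apply, RelIso.mul_apply, hXpow, hY, hX, hY, mul_add, hμl]
    · rw [mul_assoc, mul_assoc, inv_mul_eq_iff_eq_mul, mul_one, inv_mul_eq_iff_eq_mul]
      refine hext _ _ fun r s i => ?_
      rw [RelIso.mul_apply, RelIso.mul_apply, hZ, hX, hX, hZ]
    · rw [mul_assoc, mul_assoc, inv_mul_eq_iff_eq_mul, mul_one, inv_mul_eq_iff_eq_mul]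
      refine hext _ _ fun r s i => ?_
      rw [RelIso.mul_apply, RelIso.mul_apply, hZ, hY, hY, hZ]
  let ρ : XYZGroup p m n l →* _ := PresentedGroup.toGroup hrel
  let x : XYZGroup p m n l := PresentedGroup.of 0
  let y : XYZGroup p m n l := PresentedGroup.of 1
  let z : XYZGroup p m n l := PresentedGroup.of 2
  have hρx : ρ x = X := PresentedGroup.toGroup.of hrel
  have hρy : ρ y = Y := PresentedGroup.toGroup.of hrel
  have hρz : ρ z = Z := PresentedGroup.toGroup.of hrel
  have hone : ∀ r ∈ relators p m n l, PresentedGroup.mk (relators p m n l) r = 1 :=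
    fun r hr => PresentedGroup.one_of_mem hr
  have hx : x ^ p ^ (m - 1) = 1 := hone (of 0 ^ p ^ (m - 1)) (by simp [relators])
  have hy : y ^ p ^ n = 1 := hone (of 1 ^ p ^ n) (by simp [relators])
  have hz : z ^ p = 1 := hone (of 2 ^ p) (by simp [relators])
  have hxy : x * y = y * x ^ lv := by
    have : y⁻¹ * x * y * (x ^ lv)⁻¹ = 1 :=
      hone ((of 1)⁻¹ * of 0 * of 1 * (of 0 ^ lv)⁻¹) (by simp [relators, hlv])
    rwa [mul_inv_eq_one, mul_assoc, inv_mul_eq_iff_eq_mul] at this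
  have hzx : Commute z x := by
    have : z⁻¹ * x⁻¹ * z * x = 1 := hone ((of 2)⁻¹ * (of 0)⁻¹ * of 2 * of 0) (by simp [relators])
    rwa [mul_assoc, mul_assoc, inv_mul_eq_iff_eq_mul, mul_one, inv_mul_eq_iff_eq_mul] at this
  have hzy : Commute z y := by
    have : z⁻¹ * y⁻¹ * z * y = 1 := hone ((of 2)⁻¹ * (of 1)⁻¹ * of 2 * of 1) (by simp [relators])
    rwa [mul_assoc, mul_assoc, inv_mul_eq_iff_eq_mul, mul_one, inv_mul_eq_iff_eq_mul] at this
  have htop : Subgroup.closure {x, y, z} = ⊤ := by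
    rw [← PresentedGroup.closure_range_of (relators p m n l)]
    congr 1
    ext g
    simp only [Set.mem_insert_iff, Set.mem_singleton_iff, Set.mem_range, Fin.exists_fin_succ,
      IsEmpty.exists_iff, or_false, x, y, z]
    simp [eq_comm]
  have hnf := exists_eq_pow_mul_pow_mul_pow (pow_pos hp.pos (m - 1)) (pow_pos hp.pos n) hp.pos
    hx hy hz hxy hzx hzy htop
  have hact : ∀ i j k : ℕ, ρ (y ^ i * x ^ j * z ^ k) (e.symm (0, 0), 0) =
      (e.symm (μ ^ i * j, k), -(i : ZMod (p ^ n))) := fun i j k => by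
    rw [map_mul, map_mul, map_pow, map_pow, map_pow, hρx, hρy, hρz, RelIso.mul_apply,
      RelIso.mul_apply, hZpow, hXpow, hYpow, zero_add, zero_add, zero_sub]
  refine .of_bijective ρ (e.symm (0, 0), 0) ⟨fun g g' hgg => ?_, fun v => ?_⟩
  · obtain ⟨i, j, k, rfl⟩ := hnf g
    obtain ⟨i', j', k', rfl⟩ := hnf g'
    have hpow : ∀ {w : XYZGroup p m n l} {q s t : ℕ}, w ^ q = 1 → (s : ZMod q) = t →
        w ^ s = w ^ t := fun {w q s t} hw hst =>
      pow_eq_pow_iff_modEq.2 (((ZMod.natCast_eq_natCast_iff _ _ _).1 hst).of_dvd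
        (orderOf_dvd_of_pow_eq_one hw))
    simp only [hact, Prod.mk.injEq, neg_inj, EmbeddingLike.apply_eq_iff_eq] at hgg
    obtain ⟨⟨hj, hk⟩, hi⟩ := hgg
    have hi' : μ ^ i = μ ^ i' := by
      have hmod : i % p ^ n = i' % p ^ n := (ZMod.natCast_eq_natCast_iff _ _ _).1 hi
      rw [pow_eq_pow_mod i hμpow, pow_eq_pow_mod i' hμpow, hmod]
    rw [hi'] at hj
    rw [hpow hy hi, hpow hx (((H.isUnit_L (-1)).pow i').mul_left_cancel hj), hpow hz hk]
  · obtain ⟨a, i⟩ := v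
    -- The exponent of `y` is `-i` because `Y` lowers layers; the factor `lv ^ (-i).val` cancels the
    -- resulting power of `μ`.
    refine ⟨y ^ (-i).val * x ^ (lv ^ (-i).val * (e a).1).val * z ^ (e a).2.val, ?_⟩
    dsimp only
    rw [hact, ZMod.natCast_zmod_val, ZMod.natCast_zmod_val, ZMod.natCast_zmod_val, ← mul_assoc,
      ← mul_pow, hμl, one_pow, one_mul, neg_neg]
    simp

end MultilayerPetersen

theorem theorem5p1 (p m n : ℕ) (hp : p.Prime) (hp2 : p ≠ 2) (hmn : n + 2 ≤ m) (hn : 3 ≤ n + 2)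
    (l : (ZMod (p ^ m))ˣ) (hl : orderOf l = p ^ (n + 1)) :
    (MultilayerPetersen.graph (p ^ m) (p ^ n) (p ^ (m - 1)) l).IsMetacirculant ∧
    (MultilayerPetersen.graph (p ^ m) (p ^ n) (p ^ (m - 1)) l).IsWeakMetacirculant ∧
    ¬ IsMetacyclic (MultilayerPetersen.XYZGroup p m n l) ∧
    (MultilayerPetersen.graph (p ^ m) (p ^ n) (p ^ (m - 1)) l).IsCayleyGraphOf
      (MultilayerPetersen.XYZGroup p m n l) ∧
    ∀ (G : Type*) [Group G], IsMetacyclic G →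
      ¬ (MultilayerPetersen.graph (p ^ m) (p ^ n) (p ^ (m - 1)) l).IsCayleyGraphOf G := by
  have hn' : 1 ≤ n := by omega
  have hmeta := MultilayerPetersen.isMetacirculant_graph hp hp2 hmn hn' hl
  have hcay := MultilayerPetersen.isCayleyGraphOf_xyzGroup hp hp2 hmn hn' hl
  exact ⟨hmeta, hmeta.isWeakMetacirculant,
    fun h => MultilayerPetersen.not_isCayleyGraphOf_of_isMetacyclic hp hp2 hmn hn' hl h hcay, hcay,
    fun _ _ h => MultilayerPetersen.not_isCayleyGraphOf_of_isMetacyclic hp hp2 hmn hn' hl h⟩
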